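/- Let $p>0$ and let $S=\{re^{i\theta}: r>0,\ 0<\theta<\pi/(p+1)\}$ be the open planar $\pi/(p+1)$-sector with density $r^{p}$, where $r=|z|$. For a measurable set $E\subseteq S$ let $|E|_p=\int_E |z|^{p}\,dz$ be its weighted area, and let $$P_p(E)=\sup\Big\{\int_E \operatorname{div}X\,dz:\ X\in C^1_c(S;\mathbb{R}^2),\ |X(z)|\le |z|^{p}\text{ for all }z\Big\}\in[0,\infty]$$ be its weighted perimeter in $S$ (so the boundary of the sector is not counted). A measurable set $E\subseteq S$ with $|E|_p=A$ is called an isoperimetric region of weighted area $A$ if $P_p(E)\le P_p(F)$ for every measurable $F\subseteq S$ with $|F|_p=A$. An isoperimetric curve enclosing weighted area $A$ is the boundary in $S$ of such a region $E$, modulo null sets, that is, the set of points of $S$ every neighbourhood of which meets both $E$ and $S\setminus E$ in positive Lebesgue measure. Theorem. For every $A>0$ there is $R>0$ such that the disc sector $\{z\in S:|z|<R\}$ has weighted area $A$, a set is an isoperimetric region of weighted area $A$ if and only if it is a measurable subset of $S$ that agrees with $\{z\in S:|z|<R\}$ up to a Lebesgue null set, and a set is an isoperimetric curve enclosing weighted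 area $A$ if and only if it is the circular arc $\{z\in S:|z|=R\}$ about the origin. -/

import Mathlib

open MeasureTheory

noncomputable section

namespace SectorIso

/-- The open planar sector of angle `θ₀`: all points `r e^{iθ}` with `r > 0` and `0 < θ < θ₀`
(meant for `0 < θ₀ ≤ 2π`). The Euclidean plane is `ℂ`, with its Euclidean norm and Lebesgue
measure `volume`. -/
def sector (θ₀ : ℝ) : Set ℂ :=
  {z | ∃ r θ : ℝ, 0 < r ∧ 0 < θ ∧ θ < θ₀ ∧ z = r * Complex.exp (θ * Complex.I)}

/-- The density `r ^ p`. -/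
def powDensity (p : ℝ) (z : ℂ) : ℝ := ‖z‖ ^ p

/-- The area of `E` weighted by the density `f`. -/
def weightedArea (f : ℂ → ℝ) (E : Set ℂ) : ENNReal := ∫⁻ z in E, ENNReal.ofReal (f z)

/-- The divergence `∂ₓ X₁ + ∂_y X₂` of a planar vector field `X = X₁ + i X₂`. -/
def divergence (X : ℂ → ℂ) (z : ℂ) : ℝ :=
  (fderiv ℝ X z 1).re + (fderiv ℝ X z Complex.I).im

/-- `X` is a continuously differentiable vector field with compact support in `Ω` and `|X| ≤ f`. -/
structure IsTestField (Ω : Set ℂ) (f : ℂ → ℝ) (X : ℂ → ℂ) : Prop where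
  contDiff : ContDiff ℝ 1 X
  hasCompactSupport : HasCompactSupport X
  tsupport_subset : tsupport X ⊆ Ω
  norm_le : ∀ z, ‖X z‖ ≤ f z

/-- The perimeter of `E` in the open set `Ω` weighted by the density `f`, in the sense of
De Giorgi: the supremum of `∫_E div X` over the test fields with `|X| ≤ f`. For a density that is
continuous and positive in `Ω` this is the integral of `f` over the (reduced) boundary of `E`
inside `Ω` if `E` has locally finite perimeter in `Ω`, and `∞` otherwise; the boundary of `Ω`
is not counted. -/
def weightedPerimeter (Ω : Set ℂ) (f : ℂ → ℝ) (E : Set ℂ) : ENNReal :=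
  ⨆ (X : ℂ → ℂ) (_ : IsTestField Ω f X), ENNReal.ofReal (∫ z in E, divergence X z)

/-- `E` is an isoperimetric region of weighted area `A` in `Ω` with density `f`: it has least
weighted perimeter among all measurable regions in `Ω` of weighted area `A`. -/
structure IsIsoperimetricRegion (Ω : Set ℂ) (f : ℂ → ℝ) (A : ℝ) (E : Set ℂ) : Prop where
  measurableSet : MeasurableSet E
  subset : E ⊆ Ω
  area_eq : weightedArea f E = ENNReal.ofReal A
  perimeter_le : ∀ F : Set ℂ, MeasurableSet F → F ⊆ Ω → weightedArea f F = ENNReal.ofReal A →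
    weightedPerimeter Ω f E ≤ weightedPerimeter Ω f F

/-- The boundary inside `Ω` of the region `E`, taken modulo null sets: the points of `Ω` every
neighbourhood of which meets both `E` and `Ω \ E` in positive area. -/
def boundaryIn (Ω E : Set ℂ) : Set ℂ :=
  {z ∈ Ω | ∀ ε > 0, volume (E ∩ Metric.ball z ε) ≠ 0 ∧ volume ((Ω \ E) ∩ Metric.ball z ε) ≠ 0}

/-- `C` is an isoperimetric curve enclosing weighted area `A`: the boundary, inside `Ω`, of an
isoperimetric region of weighted area `A`. -/
def IsIsoperimetricCurve (Ω : Set ℂ) (f : ℂ → ℝ) (A : ℝ) (C : Set ℂ) : Prop :=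
  ∃ E : Set ℂ, IsIsoperimetricRegion Ω f A E ∧ C = boundaryIn Ω E

/-- The part of the `θ₀`-sector at distance less than `R` from the origin. -/
def discSector (θ₀ R : ℝ) : Set ℂ := {z ∈ sector θ₀ | ‖z‖ < R}

/-- The circular arc of radius `R` about the origin in the `θ₀`-sector. -/
def circularArc (θ₀ R : ℝ) : Set ℂ := {z ∈ sector θ₀ | ‖z‖ = R}

end SectorIso

end

noncomputable section

namespace SectorIso

open Set Filter Topology

/-! The map `z ↦ z ^ (p + 1) / (p + 1)` sends the sector conformally onto the upper half plane and
its derivative has modulus `r ^ p`. Weighted perimeter thus dominates the Euclidean perimeter of the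
image (`weightedPerimeter_sectorMap_image_le`), while the Euclidean area of the image is `∫ r ^ (2
p)`, the conformal area. The half-plane isoperimetric inequality, perimeter² ≥ 2π · area, therefore
bounds the conformal area above by the weighted perimeter
(`conformalArea_le_of_weightedPerimeter_le`). Conversely, among sets with a prescribed value of `∫ r
^ p`, the disc sector alone, up to null sets, has least conformal area, because `r ^ p` increases
with `r` (`ae_eq_discSector_of_conformalArea_le`). The image of a disc sector is a half disc centred
at the origin, for which the half-plane inequality is sharp. The two estimates close up, and
equality in the second gives uniqueness.

The half-plane inequality (`sqrt_two_pi_mul_le_weightedPerimeter_upperHalf`) is proved with a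
gravitational field as test field. Let `F` be a bounded part of the region and `F'` its union with
its mirror image. The field of `F'` with kernel `z / |z| ^ 2` has divergence `2π` on `F'` and `0`
elsewhere, is tangential on the real axis by symmetry, and has length at most `√(π |F'|) = √(2π
|F|)`. The last bound is a rearrangement fact: a component of the field is the integral of a dipole,
which is largest for a disc through the point (`setLIntegral_dipole_le`). Dividing by this bound and
testing the perimeter gives `2π |F| / √(2π |F|) = √(2π |F|)`. The kernel is regularized at scale
`δ`, which keeps the divergence nonnegative. Test fields must vanish near the axis and at infinity;
a cutoff achieves this at no cost in the limit
(`ofReal_setIntegral_divergence_le_weightedPerimeter`). -/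

/-! ### Rearrangement bound for the dipole -/

/-- Integration in polar coordinates, as an iterated integral. -/
lemma lintegral_polar {f : ℂ → ENNReal} (hf : Measurable f) :
    ∫⁻ z, f z = ∫⁻ θ in Ioo (-Real.pi) Real.pi, ∫⁻ r in Ioi (0 : ℝ),
      ENNReal.ofReal r * f (r * (Real.cos θ + Real.sin θ * Complex.I)) := by
  rw [← Complex.lintegral_comp_polarCoord_symm, polarCoord_target, Measure.volume_eq_prod,
    ← Measure.prod_restrict, lintegral_prod_symm']
  · simp only [Complex.polarCoord_symm_apply, smul_eq_mul]
  · have : Measurable fun p : ℝ × ℝ => f (Complex.polarCoord.symm p) := by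
      refine hf.comp ?_
      rw [funext Complex.polarCoord_symm_apply]
      fun_prop
    exact (measurable_fst.ennreal_ofReal).mul this

lemma polar_re (r θ : ℝ) :
    ((r : ℂ) * (Real.cos θ + Real.sin θ * Complex.I)).re = r * Real.cos θ := by
  simp [-Complex.ofReal_cos, -Complex.ofReal_sin]

lemma norm_polar (r θ : ℝ) :
    ‖(r : ℂ) * (Real.cos θ + Real.sin θ * Complex.I)‖ = |r| := by
  rw [← Complex.polarCoord_symm_apply (r, θ), Complex.norm_polarCoord_symm]

/-- In polar coordinates the excess of the dipole over `1 / d`, times the Jacobian `r`, is `cos θ -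
r / d`. Its positive part along a ray bounds a right triangle with legs `c` and `d * c`. -/
lemma lintegral_Ioi_linear_le {c d : ℝ} (hd : 0 < d) :
    ∫⁻ r in Ioi (0 : ℝ), ENNReal.ofReal (c - r / d) ≤
      if 0 < c then ENNReal.ofReal (d * c ^ 2 / 2) else 0 := by
  split_ifs with hc
  · have h1 : ∫⁻ r in Ioi (0 : ℝ), ENNReal.ofReal (c - r / d) ≤
        ∫⁻ r in Ioc (0 : ℝ) (d * c), ENNReal.ofReal (c - r / d) := by
      rw [← lintegral_indicator measurableSet_Ioi, ← lintegral_indicator measurableSet_Ioc]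
      refine lintegral_mono fun r => ?_
      by_cases h0 : 0 < r
      · by_cases h2 : r ≤ d * c
        · rw [indicator_of_mem (mem_Ioi.2 h0), indicator_of_mem (mem_Ioc.2 ⟨h0, h2⟩)]
        · rw [indicator_of_mem (mem_Ioi.2 h0), ENNReal.ofReal_of_nonpos]
          · exact zero_le
          · have : c ≤ r / d := by rw [le_div_iff₀ hd]; linarith
            linarith
      · rw [indicator_of_notMem (by simpa using h0)]
        exact zero_le
    refine h1.trans ?_
    have hint : IntegrableOn (fun r : ℝ => c - r / d) (Ioc 0 (d * c)) := by
      refine (Continuous.integrableOn_Icc ?_).mono_set Ioc_subset_Icc_self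
      fun_prop
    rw [← ofReal_integral_eq_lintegral_ofReal hint, ← intervalIntegral.integral_of_le (by positivity)]
    · refine ENNReal.ofReal_le_ofReal (le_of_eq ?_)
      rw [intervalIntegral.integral_sub (by simp) (by
        exact (continuous_id.div_const d).intervalIntegrable _ _), intervalIntegral.integral_div,
        integral_id]
      simp
      field_simp
      ring
    · refine (ae_restrict_mem measurableSet_Ioc).mono fun r hr => ?_
      have : r / d ≤ c := by rw [div_le_iff₀ hd]; linarith [hr.2]
      simpa using this
  · refine le_of_eq ?_
    rw [setLIntegral_congr_fun measurableSet_Ioi (g := fun _ => 0)]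
    · simp
    · intro r hr
      have : 0 < r / d := div_pos hr hd
      exact ENNReal.ofReal_of_nonpos (by linarith)

/-- The integral of the excess of the dipole `Re z / |z| ^ 2` over the level `1 / d`, whose
superlevel set is a disc of diameter `d` through the origin. -/
lemma lintegral_dipole_excess_le {d : ℝ} (hd : 0 < d) :
    ∫⁻ z : ℂ, ENNReal.ofReal (z.re / ‖z‖ ^ 2 - 1 / d) ≤ ENNReal.ofReal (Real.pi * d / 4) := by
  rw [lintegral_polar (by fun_prop)]
  have h1 : ∀ θ : ℝ, ∫⁻ r in Ioi (0 : ℝ), ENNReal.ofReal r * ENNReal.ofReal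
      (((r : ℂ) * (Real.cos θ + Real.sin θ * Complex.I)).re /
        ‖(r : ℂ) * (Real.cos θ + Real.sin θ * Complex.I)‖ ^ 2 - 1 / d) ≤
      if 0 < Real.cos θ then ENNReal.ofReal (d * Real.cos θ ^ 2 / 2) else 0 := by
    intro θ
    refine le_trans (le_of_eq ?_) (lintegral_Ioi_linear_le hd)
    refine setLIntegral_congr_fun measurableSet_Ioi fun r hr => ?_
    have hr' : (0 : ℝ) < r := hr
    simp only [norm_polar, polar_re]
    rw [← ENNReal.ofReal_mul hr'.le, sq_abs]
    congr 1
    field_simp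
  refine (lintegral_mono h1).trans ?_
  have h2 : ∫⁻ θ in Ioo (-Real.pi) Real.pi,
      (if 0 < Real.cos θ then ENNReal.ofReal (d * Real.cos θ ^ 2 / 2) else 0) ≤
      ∫⁻ θ in Ioc (-(Real.pi / 2)) (Real.pi / 2), ENNReal.ofReal (d * Real.cos θ ^ 2 / 2) := by
    rw [← lintegral_indicator measurableSet_Ioo, ← lintegral_indicator measurableSet_Ioc]
    refine lintegral_mono fun θ => ?_
    by_cases hθ : θ ∈ Ioo (-Real.pi) Real.pi
    · rw [indicator_of_mem hθ]
      split_ifs with hc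
      · rw [indicator_of_mem]
        constructor
        · by_contra! h
          have := Real.cos_nonpos_of_pi_div_two_le_of_le (x := -θ) (by linarith)
            (by linarith [hθ.1, Real.pi_pos])
          rw [Real.cos_neg] at this
          linarith
        · by_contra! h
          have := Real.cos_nonpos_of_pi_div_two_le_of_le (x := θ) (by linarith)
            (by linarith [hθ.2, Real.pi_pos])
          linarith
      · exact zero_le
    · rw [indicator_of_notMem hθ]
      exact zero_le
  refine h2.trans ?_
  rw [← ofReal_integral_eq_lintegral_ofReal, ← intervalIntegral.integral_of_le
    (by linarith [Real.pi_pos])]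
  · refine ENNReal.ofReal_le_ofReal (le_of_eq ?_)
    rw [intervalIntegral.integral_div, intervalIntegral.integral_const_mul, integral_cos_sq]
    simp
    ring
  · exact (Continuous.integrableOn_Icc (by fun_prop)).mono_set Ioc_subset_Icc_self
  · exact Eventually.of_forall fun θ => by positivity

/-- Among the sets of given area a disc through the origin maximizes the integral of the
positive part of the dipole; stated after a measure-preserving change of variables. -/
lemma setLIntegral_dipole_le {G : Set ℂ} (hG : volume G ≠ ⊤) {T : ℂ → ℂ}
    (hT : MeasurePreserving T) :
    ∫⁻ z in G, ENNReal.ofReal ((T z).re / ‖T z‖ ^ 2) ≤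
      ENNReal.ofReal (√(Real.pi * (volume G).toReal)) := by
  set m := (volume G).toReal with hm
  rcases eq_or_ne (volume G) 0 with h0 | h0
  · rw [Measure.restrict_eq_zero.2 h0]; simp
  have hm0 : 0 < m := ENNReal.toReal_pos h0 hG
  set s := √(Real.pi * m) with hs
  have hs0 : 0 < s := Real.sqrt_pos.2 (by positivity)
  have hss : s ^ 2 = Real.pi * m := Real.sq_sqrt (by positivity)
  -- The disc of diameter `d` has area `π d² / 4 = m`; this choice minimizes the bound `π d / 4 + m
  -- / d`.
  set d := 2 * s / Real.pi with hd
  have hd0 : 0 < d := by positivity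
  have hTm := hT.measurable
  calc ∫⁻ z in G, ENNReal.ofReal ((T z).re / ‖T z‖ ^ 2)
      ≤ ∫⁻ z in G, (ENNReal.ofReal ((T z).re / ‖T z‖ ^ 2 - 1 / d) + ENNReal.ofReal (1 / d)) := by
        refine lintegral_mono fun z => ?_
        refine le_trans (le_of_eq ?_) ENNReal.ofReal_add_le
        ring_nf
    _ = (∫⁻ z in G, ENNReal.ofReal ((T z).re / ‖T z‖ ^ 2 - 1 / d)) +
          ENNReal.ofReal (1 / d) * volume G := by
        rw [lintegral_add_left (by fun_prop), setLIntegral_const]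
    _ ≤ ENNReal.ofReal (Real.pi * d / 4) + ENNReal.ofReal (1 / d) * ENNReal.ofReal m := by
        rw [ENNReal.ofReal_toReal hG]
        gcongr
        -- Only the excess over the level `1 / d` is integrated over the whole plane, so the shape
        -- of `G` no longer matters.
        refine (setLIntegral_le_lintegral _ _).trans ?_
        rw [hT.lintegral_comp (f := fun z => ENNReal.ofReal (z.re / ‖z‖ ^ 2 - 1 / d))
          (by fun_prop)]
        exact lintegral_dipole_excess_le hd0
    _ = ENNReal.ofReal s := by
        rw [← ENNReal.ofReal_mul (by positivity), ← ENNReal.ofReal_add (by positivity)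
          (by positivity)]
        congr 1
        rw [hd]
        have : m = s ^ 2 / Real.pi := by rw [hss]; field_simp
        rw [this]
        field_simp
        ring

/-! ### The regularized Newtonian field of a planar set -/

/-- The divergence of a field as a continuous linear function of its derivative. -/
def divergenceCLM : (ℂ →L[ℝ] ℂ) →L[ℝ] ℝ :=
  Complex.reCLM.comp (ContinuousLinearMap.apply ℝ ℂ (1 : ℂ)) +
    Complex.imCLM.comp (ContinuousLinearMap.apply ℝ ℂ Complex.I)

lemma divergenceCLM_apply (L : ℂ →L[ℝ] ℂ) : divergenceCLM L = (L 1).re + (L Complex.I).im := rfl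

lemma divergence_eq (X : ℂ → ℂ) (z : ℂ) : divergence X z = divergenceCLM (fderiv ℝ X z) := rfl

/-- The Newtonian kernel `z / |z| ^ 2` of the plane, regularized at scale `δ`. -/
def newtonKernel (δ : ℝ) (z : ℂ) : ℂ := (‖z‖ ^ 2 + δ ^ 2)⁻¹ • z

/-- The derivative of the regularized Newtonian kernel. -/
def newtonKernelDeriv (δ : ℝ) (z : ℂ) : ℂ →L[ℝ] ℂ :=
  (‖z‖ ^ 2 + δ ^ 2)⁻¹ • ContinuousLinearMap.id ℝ ℂ +
    ((-((‖z‖ ^ 2 + δ ^ 2) ^ 2)⁻¹) • ((2 : ℝ) • innerSL ℝ z)).smulRight z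

/-- The divergence of the regularized Newtonian kernel. -/
def newtonDensity (δ : ℝ) (z : ℂ) : ℝ := 2 * δ ^ 2 / (‖z‖ ^ 2 + δ ^ 2) ^ 2

lemma hasFDerivAt_newtonKernel {δ : ℝ} (hδ : 0 < δ) (z : ℂ) :
    HasFDerivAt (newtonKernel δ) (newtonKernelDeriv δ z) z := by
  have h0 : ‖z‖ ^ 2 + δ ^ 2 ≠ 0 := by positivity
  have h1 : HasFDerivAt (fun z : ℂ => ‖z‖ ^ 2 + δ ^ 2) ((2 : ℝ) • innerSL ℝ z) z := by
    have := (hasStrictFDerivAt_norm_sq z).hasFDerivAt.add_const (δ ^ 2)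
    exact this.congr_fderiv (by ext v; simp; ring)
  have h2 := (hasDerivAt_inv h0).comp_hasFDerivAt z h1
  exact h2.smul (hasFDerivAt_id z)

lemma newtonKernelDeriv_apply (δ : ℝ) (z v : ℂ) :
    newtonKernelDeriv δ z v = (‖z‖ ^ 2 + δ ^ 2)⁻¹ • v +
      ((-((‖z‖ ^ 2 + δ ^ 2) ^ 2)⁻¹) * (2 * inner ℝ z v)) • z := by
  simp [newtonKernelDeriv]

lemma divergenceCLM_newtonKernelDeriv {δ : ℝ} (hδ : 0 < δ) (z : ℂ) :
    divergenceCLM (newtonKernelDeriv δ z) = newtonDensity δ z := by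
  have h0 : ‖z‖ ^ 2 + δ ^ 2 ≠ 0 := by positivity
  have h1 : ‖z‖ ^ 2 = z.re ^ 2 + z.im ^ 2 := by
    rw [← Complex.normSq_eq_norm_sq, Complex.normSq_apply]; ring
  have h2 : inner ℝ z 1 = z.re := by simp [Complex.inner]
  have h3 : inner ℝ z Complex.I = z.im := by simp [Complex.inner]
  rw [divergenceCLM_apply, newtonKernelDeriv_apply, newtonKernelDeriv_apply, newtonDensity, h2, h3]
  simp only [Complex.add_re, Complex.add_im, Complex.smul_re, Complex.smul_im, smul_eq_mul,
    Complex.one_re, Complex.I_im]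
  rw [h1] at h0 ⊢
  field_simp
  ring

lemma norm_newtonKernel_le {δ : ℝ} (hδ : 0 < δ) (z : ℂ) : ‖newtonKernel δ z‖ ≤ 1 / δ := by
  rw [newtonKernel, norm_smul, norm_inv, Real.norm_of_nonneg (by positivity),
    inv_mul_eq_div, div_le_div_iff₀ (by positivity) hδ]
  nlinarith [sq_nonneg (‖z‖ - δ), norm_nonneg z, mul_nonneg (norm_nonneg z) hδ.le]

lemma norm_newtonKernelDeriv_le {δ : ℝ} (hδ : 0 < δ) (z : ℂ) :
    ‖newtonKernelDeriv δ z‖ ≤ 3 / δ ^ 2 := by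
  have hA : 0 < ‖z‖ ^ 2 + δ ^ 2 := by positivity
  refine ContinuousLinearMap.opNorm_le_bound _ (by positivity) fun v => ?_
  have h1 : ‖inner ℝ z v‖ ≤ ‖z‖ * ‖v‖ := norm_inner_le_norm z v
  rw [newtonKernelDeriv_apply]
  calc _ ≤ (‖z‖ ^ 2 + δ ^ 2)⁻¹ * ‖v‖ + ((‖z‖ ^ 2 + δ ^ 2) ^ 2)⁻¹ * (2 * (‖z‖ * ‖v‖)) * ‖z‖ := by
        refine (norm_add_le _ _).trans ?_
        rw [norm_smul, norm_smul, norm_mul, norm_mul, norm_neg, norm_inv, norm_inv,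
          Real.norm_of_nonneg hA.le, Real.norm_of_nonneg (sq_nonneg (‖z‖ ^ 2 + δ ^ 2)),
          Real.norm_of_nonneg zero_le_two]
        gcongr
    _ ≤ (‖z‖ ^ 2 + δ ^ 2)⁻¹ * ‖v‖ + 2 * (‖z‖ ^ 2 + δ ^ 2)⁻¹ * ‖v‖ := by
        refine add_le_add_right ?_ _
        have : ((‖z‖ ^ 2 + δ ^ 2) ^ 2)⁻¹ * (2 * (‖z‖ * ‖v‖)) * ‖z‖ =
          2 * (‖z‖ ^ 2 + δ ^ 2)⁻¹ * ‖v‖ * (‖z‖ ^ 2 / (‖z‖ ^ 2 + δ ^ 2)) := by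
            field_simp
        rw [this]
        refine mul_le_of_le_one_right (by positivity) ?_
        rw [div_le_one hA]
        nlinarith [sq_nonneg δ]
    _ = 3 / (‖z‖ ^ 2 + δ ^ 2) * ‖v‖ := by field_simp; ring
    _ ≤ 3 / δ ^ 2 * ‖v‖ := by
        gcongr
        nlinarith [sq_nonneg ‖z‖]

lemma continuous_newtonKernel {δ : ℝ} (hδ : 0 < δ) : Continuous (newtonKernel δ) :=
  continuous_iff_continuousAt.2 fun z => (hasFDerivAt_newtonKernel hδ z).continuousAt

lemma continuous_newtonKernelDeriv {δ : ℝ} (hδ : 0 < δ) : Continuous (newtonKernelDeriv δ) := by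
  have h : ∀ z : ℂ, ‖z‖ ^ 2 + δ ^ 2 ≠ 0 := fun z => by positivity
  have h' : ∀ z : ℂ, (‖z‖ ^ 2 + δ ^ 2) ^ 2 ≠ 0 := fun z => by positivity
  unfold newtonKernelDeriv
  refine Continuous.add (Continuous.smul (Continuous.inv₀ (by fun_prop) h) continuous_const) ?_
  have h1 : Continuous fun z : ℂ =>
      (-((‖z‖ ^ 2 + δ ^ 2) ^ 2)⁻¹) • ((2 : ℝ) • innerSL ℝ z) :=
    ((Continuous.inv₀ (by fun_prop) h').neg).smul (by fun_prop)
  exact (ContinuousLinearMap.smulRightL ℝ ℂ ℂ).continuous₂.comp (h1.prodMk continuous_id)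

lemma newtonDensity_nonneg (δ : ℝ) (z : ℂ) : 0 ≤ newtonDensity δ z := by
  unfold newtonDensity; positivity

lemma newtonDensity_le {δ : ℝ} (hδ : 0 < δ) (z : ℂ) : newtonDensity δ z ≤ 2 / δ ^ 2 := by
  rw [newtonDensity, div_le_div_iff₀ (by positivity) (by positivity)]
  nlinarith [sq_nonneg (‖z‖ ^ 2), mul_nonneg (sq_nonneg ‖z‖) (sq_nonneg δ)]

lemma continuous_newtonDensity {δ : ℝ} (hδ : 0 < δ) : Continuous (newtonDensity δ) := by
  have h' : ∀ z : ℂ, (‖z‖ ^ 2 + δ ^ 2) ^ 2 ≠ 0 := fun z => by positivity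
  unfold newtonDensity
  exact Continuous.div (by fun_prop) (by fun_prop) h'

/-- The regularized gravitational field of a planar set `F`. -/
def newtonField (δ : ℝ) (F : Set ℂ) (w : ℂ) : ℂ := ∫ y in F, newtonKernel δ (w - y)

lemma integrableOn_of_norm_le {V : Type*} [NormedAddCommGroup V] {F : Set ℂ}
    (hF : volume F ≠ ⊤) {f : ℂ → V} (hf : Continuous f) {C : ℝ} (hC : ∀ z, ‖f z‖ ≤ C)
    [SecondCountableTopologyEither ℂ V] :
    IntegrableOn f F :=
  Measure.integrableOn_of_bounded hF hf.aestronglyMeasurable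
    (Eventually.of_forall hC)

lemma hasFDerivAt_newtonField {δ : ℝ} (hδ : 0 < δ) {F : Set ℂ} (hF : volume F ≠ ⊤) (w : ℂ) :
    HasFDerivAt (newtonField δ F) (∫ y in F, newtonKernelDeriv δ (w - y)) w := by
  have hfin : IsFiniteMeasure (volume.restrict F) := ⟨by simpa using hF.lt_top⟩
  refine hasFDerivAt_integral_of_dominated_of_fderiv_le (bound := fun _ => 3 / δ ^ 2)
    (F' := fun w y => newtonKernelDeriv δ (w - y)) (s := univ) univ_mem ?_ ?_ ?_ ?_ ?_ ?_
  · refine Eventually.of_forall fun x => ?_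
    exact ((continuous_newtonKernel hδ).comp (continuous_sub_left x)).aestronglyMeasurable
  · exact integrableOn_of_norm_le hF ((continuous_newtonKernel hδ).comp (continuous_sub_left w))
      fun z => norm_newtonKernel_le hδ _
  · exact ((continuous_newtonKernelDeriv hδ).comp (continuous_sub_left w)).aestronglyMeasurable
  · exact Eventually.of_forall fun y x _ => norm_newtonKernelDeriv_le hδ _
  · exact integrable_const _
  · refine Eventually.of_forall fun y x _ => ?_
    exact (hasFDerivAt_newtonKernel hδ (x - y)).comp x ((hasFDerivAt_id x).sub_const y)

lemma contDiff_newtonField {δ : ℝ} (hδ : 0 < δ) {F : Set ℂ} (hF : volume F ≠ ⊤) :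
    ContDiff ℝ 1 (newtonField δ F) := by
  have hfin : IsFiniteMeasure (volume.restrict F) := ⟨by simpa using hF.lt_top⟩
  refine contDiff_one_iff_hasFDerivAt.2 ⟨_, ?_, hasFDerivAt_newtonField hδ hF⟩
  refine continuous_of_dominated (bound := fun _ => 3 / δ ^ 2) (fun w => ?_) (fun w => ?_)
    (integrable_const _) (Eventually.of_forall fun y => ?_)
  · exact ((continuous_newtonKernelDeriv hδ).comp (continuous_sub_left w)).aestronglyMeasurable
  · exact Eventually.of_forall fun y => norm_newtonKernelDeriv_le hδ _
  · exact (continuous_newtonKernelDeriv hδ).comp (continuous_sub_right y)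

lemma divergence_newtonField {δ : ℝ} (hδ : 0 < δ) {F : Set ℂ} (hF : volume F ≠ ⊤) (w : ℂ) :
    divergence (newtonField δ F) w = ∫ y in F, newtonDensity δ (w - y) := by
  rw [divergence_eq, (hasFDerivAt_newtonField hδ hF w).fderiv,
    ← ContinuousLinearMap.integral_comp_comm]
  · simp_rw [divergenceCLM_newtonKernelDeriv hδ]
  · exact integrableOn_of_norm_le hF
      ((continuous_newtonKernelDeriv hδ).comp (continuous_sub_left w))
      fun z => norm_newtonKernelDeriv_le hδ _

lemma ofReal_integral_le_lintegral {α : Type*} [MeasurableSpace α] (μ : Measure α) (f : α → ℝ) :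
    ENNReal.ofReal (∫ x, f x ∂μ) ≤ ∫⁻ x, ENNReal.ofReal (f x) ∂μ := by
  by_cases hf : Integrable f μ
  · rw [integral_eq_lintegral_pos_part_sub_lintegral_neg_part hf]
    refine (ENNReal.ofReal_le_ofReal (sub_le_self _ ENNReal.toReal_nonneg)).trans ?_
    exact ENNReal.ofReal_toReal_le
  · rw [integral_undef hf]; simp

/-- Rotating the field at `w` onto the positive real axis turns its length into the integral of a
real part. Regularization only shrinks the positive part of that integrand, so the dipole bound
applies, uniformly in `δ`. -/
lemma norm_newtonField_le {δ : ℝ} (hδ : 0 < δ) {F : Set ℂ} (hF : volume F ≠ ⊤) (w : ℂ) :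
    ‖newtonField δ F w‖ ≤ √(Real.pi * (volume F).toReal) := by
  rcases eq_or_ne (newtonField δ F w) 0 with h0 | h0
  · rw [h0, norm_zero]; exact Real.sqrt_nonneg _
  set Y := newtonField δ F w with hY
  have hY0 : 0 < ‖Y‖ := norm_pos_iff.2 h0
  set u : ℂ := (starRingEnd ℂ) Y / ‖Y‖ with hu
  have hu1 : ‖u‖ = 1 := by
    rw [hu, norm_div, RCLike.norm_conj, Complex.norm_real, norm_norm, div_self hY0.ne']
  have huY : (u * Y).re = ‖Y‖ := by
    rw [hu, div_mul_eq_mul_div, mul_comm, Complex.mul_conj, Complex.normSq_eq_norm_sq]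
    rw [← Complex.ofReal_div, Complex.ofReal_re]
    field_simp
  have hint : IntegrableOn (fun y => newtonKernel δ (w - y)) F :=
    integrableOn_of_norm_le hF ((continuous_newtonKernel hδ).comp (continuous_sub_left w))
      fun z => norm_newtonKernel_le hδ _
  have h1 : ‖Y‖ = ∫ y in F, (u * newtonKernel δ (w - y)).re := by
    rw [← huY, hY, newtonField, ← integral_const_mul]
    exact (integral_re (hint.const_mul u)).symm
  have hT : MeasurePreserving fun y : ℂ => u * (w - y) := by
    have h3 : MeasurePreserving fun y : ℂ => u * y :=
      (rotation ⟨u, by simpa [Submonoid.unitSphere] using hu1⟩).measurePreserving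
    exact h3.comp (Measure.measurePreserving_sub_left volume w)
  have h4 : ENNReal.ofReal ‖Y‖ ≤ ENNReal.ofReal (√(Real.pi * (volume F).toReal)) := by
    refine le_trans ?_ (setLIntegral_dipole_le hF hT)
    calc ENNReal.ofReal ‖Y‖ ≤ ∫⁻ y in F, ENNReal.ofReal ((u * newtonKernel δ (w - y)).re) := by
          rw [h1]
          exact ofReal_integral_le_lintegral _ _
      _ ≤ _ := by
          refine lintegral_mono fun y => ?_
          have h5 : (u * newtonKernel δ (w - y)).re =
              (u * (w - y)).re / (‖w - y‖ ^ 2 + δ ^ 2) := by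
            rw [newtonKernel, mul_smul_comm, Complex.smul_re, smul_eq_mul, inv_mul_eq_div]
          rw [h5, norm_mul, hu1, one_mul]
          rcases le_or_gt (u * (w - y)).re 0 with h6 | h6
          · rw [ENNReal.ofReal_of_nonpos (div_nonpos_of_nonpos_of_nonneg h6 (by positivity))]
            exact zero_le
          · refine ENNReal.ofReal_le_ofReal ?_
            have h7 : 0 < ‖w - y‖ := by
              rw [norm_pos_iff]
              rintro h8
              rw [h8] at h6
              simp at h6
            gcongr
            nlinarith [sq_nonneg δ]
  exact (ENNReal.ofReal_le_ofReal_iff (Real.sqrt_nonneg _)).1 h4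

/-! ### The divergence as an approximate identity -/

/-- The left side is the flux of `newtonKernel δ` through the circle of radius `r`. The radial
integral is explicit, with antiderivative `-δ² / (x² + δ²)`. -/
lemma le_lintegral_newtonDensity_ball {δ r : ℝ} (hδ : 0 < δ) (hr : 0 < r) :
    ENNReal.ofReal (2 * Real.pi * (r ^ 2 / (r ^ 2 + δ ^ 2))) ≤
      ∫⁻ h in Metric.ball (0 : ℂ) r, ENNReal.ofReal (newtonDensity δ h) := by
  have hm : Measurable fun h => ENNReal.ofReal (newtonDensity δ h) :=
    (continuous_newtonDensity hδ).measurable.ennreal_ofReal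
  rw [← lintegral_indicator Metric.isOpen_ball.measurableSet,
    lintegral_polar (hm.indicator Metric.isOpen_ball.measurableSet)]
  have hd : ∀ x : ℝ, HasDerivAt (fun x : ℝ => -δ ^ 2 / (x ^ 2 + δ ^ 2))
      (2 * δ ^ 2 * x / (x ^ 2 + δ ^ 2) ^ 2) x := by
    intro x
    have h0 : x ^ 2 + δ ^ 2 ≠ 0 := by positivity
    have h1 : HasDerivAt (fun x : ℝ => x ^ 2 + δ ^ 2) (2 * x) x := by
      simpa using (hasDerivAt_pow 2 x).add_const (δ ^ 2)
    convert! (hasDerivAt_const x (-δ ^ 2)).div h1 h0 using 1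
    ring
  have hc : Continuous fun x : ℝ => 2 * δ ^ 2 * x / (x ^ 2 + δ ^ 2) ^ 2 :=
    Continuous.div (by fun_prop) (by fun_prop) fun x => by positivity
  have hinner : ∀ θ : ℝ, ENNReal.ofReal (r ^ 2 / (r ^ 2 + δ ^ 2)) ≤
      ∫⁻ ρ in Ioi (0 : ℝ), ENNReal.ofReal ρ * (Metric.ball (0 : ℂ) r).indicator
        (fun h => ENNReal.ofReal (newtonDensity δ h))
        (ρ * (Real.cos θ + Real.sin θ * Complex.I)) := by
    intro θ
    have h1 : r ^ 2 / (r ^ 2 + δ ^ 2) =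
        ∫ ρ in Ioo 0 r, 2 * δ ^ 2 * ρ / (ρ ^ 2 + δ ^ 2) ^ 2 := by
      rw [← integral_Ioc_eq_integral_Ioo, ← intervalIntegral.integral_of_le hr.le,
        intervalIntegral.integral_eq_sub_of_hasDerivAt (fun x _ => hd x)
          (hc.intervalIntegrable _ _)]
      field_simp
      ring
    rw [h1]
    refine (ofReal_integral_le_lintegral _ _).trans ?_
    refine le_trans (le_of_eq ?_) (lintegral_mono_set fun ρ (hρ : ρ ∈ Ioo 0 r) => hρ.1)
    refine setLIntegral_congr_fun measurableSet_Ioo fun ρ hρ => ?_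
    have hρ0 : 0 < ρ := hρ.1
    rw [indicator_of_mem, newtonDensity, norm_polar, sq_abs, ← ENNReal.ofReal_mul hρ0.le]
    · congr 1
      ring
    · rw [mem_ball_zero_iff, norm_polar, abs_of_pos hρ0]
      exact hρ.2
  calc _ = ∫⁻ θ in Ioo (-Real.pi) Real.pi, ENNReal.ofReal (r ^ 2 / (r ^ 2 + δ ^ 2)) := by
        rw [setLIntegral_const, Real.volume_Ioo, ← ENNReal.ofReal_mul (by positivity)]
        congr 1
        ring
    _ ≤ _ := lintegral_mono hinner

/-- Translations of a set of finite measure are continuous in measure at the origin. -/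
lemma exists_ball_le_measure_inter_translate {F : Set ℂ} (hF : MeasurableSet F)
    (hF' : volume F ≠ ⊤) {t : ℝ} (ht0 : 0 < t) (ht1 : t < 1) :
    ∃ r > 0, ∀ h ∈ Metric.ball (0 : ℂ) r,
      ENNReal.ofReal t * volume F ≤ volume (F ∩ (fun w => w - h) ⁻¹' F) := by
  rcases eq_or_ne (volume F) 0 with h0 | h0
  · exact ⟨1, one_pos, fun h _ => by simp [h0]⟩
  let f : C(ℂ, C(ℂ, ℂ)) := ContinuousMap.curry ⟨fun p : ℂ × ℂ => p.2 - p.1, by fun_prop⟩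
  have h1 := tendsto_measure_symmDiff_preimage_nhds_zero (μ := volume) (ν := volume)
    (f.continuous.tendsto 0) (Eventually.of_forall fun h =>
      measurePreserving_sub_right volume h) (measurePreserving_sub_right volume 0)
      hF.nullMeasurableSet hF'
  have h2 : 0 < ENNReal.ofReal (1 - t) * volume F :=
    ENNReal.mul_pos (by simpa using ht1) h0
  obtain ⟨r, hr, h3⟩ := Metric.mem_nhds_iff.1 (h1.eventually (gt_mem_nhds h2))
  refine ⟨r, hr, fun h hh => ?_⟩
  have h4 : volume (symmDiff ((fun w => w - h) ⁻¹' F) F) < ENNReal.ofReal (1 - t) * volume F := by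
    have := h3 hh
    have e : (f 0) ⁻¹' F = F := by ext w; simp [f]
    rw [mem_ofPred_eq, e] at this
    exact this
  have h5 : volume F ≤ volume (F ∩ (fun w => w - h) ⁻¹' F) +
      ENNReal.ofReal (1 - t) * volume F := by
    refine le_trans ?_ (add_le_add_right h4.le _)
    refine le_trans (measure_mono ?_) (measure_union_le _ _)
    intro w hw
    by_cases hw' : w - h ∈ F
    · exact Or.inl ⟨hw, hw'⟩
    · exact Or.inr (Or.inr ⟨hw, hw'⟩)
  have h6 : volume F = ENNReal.ofReal t * volume F + ENNReal.ofReal (1 - t) * volume F := by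
    rw [← add_mul, ← ENNReal.ofReal_add ht0.le (by linarith)]
    simp
  rw [h6] at h5
  exact (ENNReal.add_le_add_iff_right (ENNReal.mul_ne_top ENNReal.ofReal_ne_top hF')).1
    (by rw [← h6] at h5 ⊢; exact h5)

/-- The regularized Newtonian densities, divided by `2 π`, form an approximate identity. -/
lemma exists_le_lintegral_lintegral_newtonDensity {F : Set ℂ} (hF : MeasurableSet F)
    (hF' : volume F ≠ ⊤) {t : ℝ} (ht0 : 0 < t) (ht1 : t < 1) :
    ∃ δ > 0, ENNReal.ofReal (t ^ 2 * (2 * Real.pi)) * volume F ≤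
      ∫⁻ w in F, ∫⁻ y in F, ENNReal.ofReal (newtonDensity δ (w - y)) := by
  obtain ⟨r, hr, h1⟩ := exists_ball_le_measure_inter_translate hF hF' ht0 ht1
  have hs : 0 < √(1 - t) := Real.sqrt_pos.2 (by linarith)
  have hss : √(1 - t) ^ 2 = 1 - t := Real.sq_sqrt (by linarith)
  -- With this `δ`, the mass fraction `r² / (r² + δ²)` is `1 / (2 - t)`, which is at least `t`.
  refine ⟨r * √(1 - t), by positivity, ?_⟩
  set δ := r * √(1 - t) with hδ
  have hδ0 : 0 < δ := by positivity
  have hm : Measurable fun h => ENNReal.ofReal (newtonDensity δ h) :=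
    (continuous_newtonDensity hδ0).measurable.ennreal_ofReal
  have hFi : Measurable (F.indicator (1 : ℂ → ENNReal)) := measurable_one.indicator hF
  -- Substituting `h = w - y` and exchanging integrals leaves the density weighted by the overlap of
  -- `F` with its translate; on the small ball this overlap is at least `t` times the area of `F`.
  have h2 : ∫⁻ w in F, ∫⁻ y in F, ENNReal.ofReal (newtonDensity δ (w - y)) =
      ∫⁻ h, ENNReal.ofReal (newtonDensity δ h) * volume (F ∩ (fun w => w - h) ⁻¹' F) := by
    calc _ = ∫⁻ w in F, ∫⁻ h, F.indicator 1 (w - h) * ENNReal.ofReal (newtonDensity δ h) := by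
          refine lintegral_congr fun w => ?_
          rw [← lintegral_indicator hF, ← lintegral_sub_left_eq_self _ w]
          refine lintegral_congr fun h => ?_
          by_cases hh : w - h ∈ F
          · simp [hh]
          · simp [hh]
      _ = ∫⁻ h, ∫⁻ w in F, F.indicator 1 (w - h) * ENNReal.ofReal (newtonDensity δ h) := by
          rw [lintegral_lintegral_swap]
          exact ((hFi.comp (measurable_fst.sub measurable_snd)).mul
            (hm.comp measurable_snd)).aemeasurable
      _ = _ := by
          refine lintegral_congr fun h => ?_
          have hFh : Measurable fun w => F.indicator (1 : ℂ → ENNReal) (w - h) :=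
            hFi.comp (measurable_sub_const h)
          rw [lintegral_mul_const _ hFh, mul_comm]
          congr 1
          have e : (fun w => F.indicator (1 : ℂ → ENNReal) (w - h)) =
              ((fun w => w - h) ⁻¹' F).indicator 1 := rfl
          rw [e, lintegral_indicator_one (measurable_sub_const h hF),
            Measure.restrict_apply (measurable_sub_const h hF), inter_comm]
  rw [h2]
  calc ENNReal.ofReal (t ^ 2 * (2 * Real.pi)) * volume F
      ≤ ENNReal.ofReal (2 * Real.pi * (r ^ 2 / (r ^ 2 + δ ^ 2))) *
          (ENNReal.ofReal t * volume F) := by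
        rw [← mul_assoc (ENNReal.ofReal _), ← ENNReal.ofReal_mul (by positivity)]
        gcongr ENNReal.ofReal ?_ * _
        have : t ≤ r ^ 2 / (r ^ 2 + δ ^ 2) := by
          rw [le_div_iff₀ (by positivity), hδ, mul_pow, hss]
          nlinarith [mul_nonneg (sq_nonneg r) (sq_nonneg (1 - t))]
        have := mul_le_mul_of_nonneg_left this (by positivity : 0 ≤ 2 * Real.pi * t)
        nlinarith
    _ ≤ (∫⁻ h in Metric.ball (0 : ℂ) r, ENNReal.ofReal (newtonDensity δ h)) *
          (ENNReal.ofReal t * volume F) := by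
        gcongr
        exact le_lintegral_newtonDensity_ball hδ0 hr
    _ = ∫⁻ h in Metric.ball (0 : ℂ) r, ENNReal.ofReal (newtonDensity δ h) *
          (ENNReal.ofReal t * volume F) := (lintegral_mul_const _ hm).symm
    _ ≤ ∫⁻ h in Metric.ball (0 : ℂ) r, ENNReal.ofReal (newtonDensity δ h) *
          volume (F ∩ (fun w => w - h) ⁻¹' F) := by
        refine setLIntegral_mono' Metric.isOpen_ball.measurableSet fun h hh => ?_
        gcongr
        exact h1 h hh
    _ ≤ _ := setLIntegral_le_lintegral _ _

/-! ### Decay of the field and tangency on the real axis -/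

lemma inv_norm_sub_sq_add_sq_le {δ N : ℝ} (hδ : 0 < δ) (w : ℂ) {y : ℂ} (hy : ‖y‖ ≤ N) :
    (‖w - y‖ ^ 2 + δ ^ 2)⁻¹ ≤ (2 + (1 + 2 * N ^ 2) / δ ^ 2) / (1 + ‖w‖ ^ 2) := by
  have h1 : ‖w‖ ≤ ‖w - y‖ + N := by
    calc ‖w‖ = ‖(w - y) + y‖ := by ring_nf
      _ ≤ ‖w - y‖ + ‖y‖ := norm_add_le _ _
      _ ≤ _ := by linarith
  have h2 : ‖w‖ ^ 2 ≤ 2 * ‖w - y‖ ^ 2 + 2 * N ^ 2 := by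
    nlinarith [sq_nonneg (‖w - y‖ - N), norm_nonneg w]
  rw [inv_eq_one_div, div_le_div_iff₀ (by positivity) (by positivity)]
  have h3 : (1 + 2 * N ^ 2) ≤ (1 + 2 * N ^ 2) / δ ^ 2 * (‖w - y‖ ^ 2 + δ ^ 2) := by
    rw [div_mul_eq_mul_div, le_div_iff₀ (by positivity)]
    gcongr
    nlinarith [sq_nonneg ‖w - y‖]
  nlinarith [sq_nonneg δ]

/-- On the real axis the normal components of a kernel and its mirror image cancel. The point is
that the cancellation is linear in `w.im`, which later absorbs the steep gradient of the cutoff. -/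
lemma abs_newtonKernel_im_add_conj_le {δ : ℝ} (hδ : 0 < δ) {w : ℂ} (hw : 0 ≤ w.im) (y : ℂ) :
    |(newtonKernel δ (w - y)).im + (newtonKernel δ (w - (starRingEnd ℂ) y)).im| ≤
      w.im * ((‖w - y‖ ^ 2 + δ ^ 2)⁻¹ + (‖w - (starRingEnd ℂ) y‖ ^ 2 + δ ^ 2)⁻¹) := by
  have e : ∀ z : ℂ, ‖z‖ ^ 2 = z.re ^ 2 + z.im ^ 2 := fun z => by
    rw [← Complex.normSq_eq_norm_sq, Complex.normSq_apply]; ring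
  have hA : 0 < ‖w - y‖ ^ 2 + δ ^ 2 := by positivity
  have hB : 0 < ‖w - (starRingEnd ℂ) y‖ ^ 2 + δ ^ 2 := by positivity
  set A := ‖w - y‖ ^ 2 + δ ^ 2 with hA'
  set B := ‖w - (starRingEnd ℂ) y‖ ^ 2 + δ ^ 2 with hB'
  rw [e] at hA' hB'
  simp only [Complex.sub_re, Complex.sub_im, Complex.conj_re, Complex.conj_im] at hA' hB'
  have h1 : (newtonKernel δ (w - y)).im + (newtonKernel δ (w - (starRingEnd ℂ) y)).im =
      w.im * (A⁻¹ + B⁻¹) - 4 * w.im * y.im ^ 2 * (A⁻¹ * B⁻¹) := by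
    rw [newtonKernel, newtonKernel, Complex.smul_im, Complex.smul_im]
    simp only [Complex.sub_im, Complex.conj_im, smul_eq_mul]
    change A⁻¹ * _ + B⁻¹ * _ = _
    have : B - A = 4 * w.im * y.im := by rw [hA', hB']; ring
    field_simp
    linear_combination -y.im * this
  have h2 : A⁻¹ + B⁻¹ = (A + B) * (A⁻¹ * B⁻¹) := by field_simp; ring
  -- The sum `A + B` contains `2 * y.im ^ 2` together with nonnegative terms.
  have h3 : 2 * y.im ^ 2 * (A⁻¹ * B⁻¹) ≤ A⁻¹ + B⁻¹ := by
    rw [h2]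
    gcongr
    rw [hA', hB']
    nlinarith [sq_nonneg (w.re - y.re), sq_nonneg w.im]
  have h4 : 0 ≤ A⁻¹ * B⁻¹ := by positivity
  have h5 := mul_le_mul_of_nonneg_left h3 hw
  rw [h1, abs_le]
  constructor
  · nlinarith
  · have : 0 ≤ 4 * w.im * y.im ^ 2 * (A⁻¹ * B⁻¹) := by positivity
    linarith

lemma measurePreserving_conj : MeasurePreserving (starRingEnd ℂ : ℂ → ℂ) :=
  Complex.conjLIE.measurePreserving

/-- The field of a bounded set that is symmetric in the real axis is tangential there. -/
lemma exists_abs_newtonField_im_le {δ N : ℝ} (hδ : 0 < δ) {F : Set ℂ}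
    (hF' : volume F ≠ ⊤) (hN : ∀ y ∈ F, ‖y‖ ≤ N)
    (hconj : (starRingEnd ℂ : ℂ → ℂ) ⁻¹' F = F) :
    ∃ C : ℝ, 0 ≤ C ∧ ∀ w : ℂ, 0 ≤ w.im →
      |(newtonField δ F w).im| ≤ C * w.im / (1 + ‖w‖ ^ 2) := by
  set D := 2 + (1 + 2 * N ^ 2) / δ ^ 2 with hD
  have hD0 : 0 ≤ D := by positivity
  refine ⟨D * (volume F).toReal, by positivity, fun w hw => ?_⟩
  have hint : IntegrableOn (fun y => newtonKernel δ (w - y)) F :=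
    integrableOn_of_norm_le hF' ((continuous_newtonKernel hδ).comp (continuous_sub_left w))
      fun z => norm_newtonKernel_le hδ _
  have hemb : MeasurableEmbedding (starRingEnd ℂ : ℂ → ℂ) :=
    Complex.conjLIE.toHomeomorph.measurableEmbedding
  have h1 : (newtonField δ F w).im = ∫ y in F, (newtonKernel δ (w - y)).im :=
    (integral_im hint).symm
  have h2 : (newtonField δ F w).im =
      ∫ y in F, (newtonKernel δ (w - (starRingEnd ℂ) y)).im := by
    rw [h1]
    conv_rhs => rw [← hconj]
    exact (measurePreserving_conj.setIntegral_preimage_emb hemb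
      (fun y => (newtonKernel δ (w - y)).im) F).symm
  -- Averaging the two expressions for the normal component pairs each source point with its
  -- reflection.
  have hint' : IntegrableOn (fun y => newtonKernel δ (w - (starRingEnd ℂ) y)) F :=
    integrableOn_of_norm_le hF' ((continuous_newtonKernel hδ).comp
      (continuous_const.sub Complex.continuous_conj)) fun z => norm_newtonKernel_le hδ _
  have h3 : 2 * (newtonField δ F w).im = ∫ y in F, ((newtonKernel δ (w - y)).im +
      (newtonKernel δ (w - (starRingEnd ℂ) y)).im) := by
    have hi : IntegrableOn (fun y => (newtonKernel δ (w - y)).im) F := hint.im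
    have hi' : IntegrableOn (fun y => (newtonKernel δ (w - (starRingEnd ℂ) y)).im) F := hint'.im
    rw [integral_add hi hi']
    exact (two_mul _).trans (congrArg₂ (· + ·) h1 h2)
  have h4 : ‖∫ y in F, ((newtonKernel δ (w - y)).im +
      (newtonKernel δ (w - (starRingEnd ℂ) y)).im)‖ ≤
      (2 * D * w.im / (1 + ‖w‖ ^ 2)) * (volume F).toReal := by
    refine norm_setIntegral_le_of_norm_le_const hF'.lt_top fun y hy => ?_
    rw [Real.norm_eq_abs]
    refine (abs_newtonKernel_im_add_conj_le hδ hw y).trans ?_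
    have h5 := inv_norm_sub_sq_add_sq_le hδ w (hN y hy)
    have h6 := inv_norm_sub_sq_add_sq_le (N := N) hδ w (y := (starRingEnd ℂ) y)
      (by rw [RCLike.norm_conj]; exact hN y hy)
    calc _ ≤ w.im * (D / (1 + ‖w‖ ^ 2) + D / (1 + ‖w‖ ^ 2)) := by gcongr
      _ = _ := by ring
  rw [← h3, Real.norm_eq_abs, abs_mul, abs_two] at h4
  calc _ ≤ (2 * D * w.im / (1 + ‖w‖ ^ 2)) * (volume F).toReal / 2 := by linarith
    _ = _ := by ring

lemma exists_divergence_newtonField_le {δ N : ℝ} (hδ : 0 < δ) {F : Set ℂ}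
    (hF' : volume F ≠ ⊤) (hN : ∀ y ∈ F, ‖y‖ ≤ N) :
    ∃ C : ℝ, 0 ≤ C ∧ ∀ w : ℂ, |divergence (newtonField δ F) w| ≤ C / (1 + ‖w‖ ^ 2) := by
  set D := 2 + (1 + 2 * N ^ 2) / δ ^ 2 with hD
  have hD0 : 0 ≤ D := by positivity
  refine ⟨2 * D * (volume F).toReal, by positivity, fun w => ?_⟩
  rw [divergence_newtonField hδ hF', ← Real.norm_eq_abs]
  refine (norm_setIntegral_le_of_norm_le_const (C := 2 * D / (1 + ‖w‖ ^ 2)) hF'.lt_top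
    fun y hy => ?_).trans (le_of_eq ?_)
  · rw [Real.norm_of_nonneg (newtonDensity_nonneg _ _), newtonDensity]
    have h5 := inv_norm_sub_sq_add_sq_le hδ w (hN y hy)
    have hA : 0 < ‖w - y‖ ^ 2 + δ ^ 2 := by positivity
    calc 2 * δ ^ 2 / (‖w - y‖ ^ 2 + δ ^ 2) ^ 2
        = 2 * (δ ^ 2 / (‖w - y‖ ^ 2 + δ ^ 2)) * (‖w - y‖ ^ 2 + δ ^ 2)⁻¹ := by field_simp
      _ ≤ 2 * 1 * (D / (1 + ‖w‖ ^ 2)) := by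
          gcongr
          rw [div_le_one hA]
          nlinarith [sq_nonneg ‖w - y‖]
      _ = _ := by ring
  · rw [measureReal_def]
    ring

/-! ### Cutoffs in the half plane -/

lemma deriv_smoothTransition_of_lt_zero {x : ℝ} (hx : x < 0) :
    deriv Real.smoothTransition x = 0 := by
  have : Real.smoothTransition =ᶠ[𝓝 x] fun _ => 0 := by
    filter_upwards [gt_mem_nhds hx] with y hy
    exact Real.smoothTransition.zero_of_nonpos (le_of_lt hy)
  rw [this.deriv_eq, deriv_const]

lemma deriv_smoothTransition_of_one_lt {x : ℝ} (hx : 1 < x) :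
    deriv Real.smoothTransition x = 0 := by
  have : Real.smoothTransition =ᶠ[𝓝 x] fun _ => 1 := by
    filter_upwards [lt_mem_nhds hx] with y hy
    exact Real.smoothTransition.one_of_one_le (le_of_lt hy)
  rw [this.deriv_eq, deriv_const]

lemma exists_abs_deriv_smoothTransition_le :
    ∃ M : ℝ, 0 ≤ M ∧ ∀ x, |deriv Real.smoothTransition x| ≤ M := by
  have hc : Continuous (deriv Real.smoothTransition) :=
    (Real.smoothTransition.contDiff (n := 1)).continuous_deriv_one
  obtain ⟨M, hM⟩ := isCompact_Icc.exists_bound_of_continuousOn (s := Icc (0 : ℝ) 1) hc.continuousOn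
  refine ⟨max M 0, le_max_right _ _, fun x => ?_⟩
  rcases lt_or_ge x 0 with h | h
  · simp [deriv_smoothTransition_of_lt_zero h]
  rcases lt_or_ge 1 x with h' | h'
  · simp [deriv_smoothTransition_of_one_lt h']
  exact (hM x ⟨h, h'⟩).trans (le_max_left _ _)

/-- The open upper half plane. -/
def upperHalf : Set ℂ := {w | 0 < w.im}

/-- A smooth function with compact support in the upper half plane that equals `1` at the points
with `2 ≤ n * im w` and `‖w‖ ≤ n`. -/
def halfPlaneCutoff (n : ℝ) (w : ℂ) : ℝ :=
  Real.smoothTransition (n * w.im - 1) * Real.smoothTransition (2 - ‖w‖ ^ 2 / n ^ 2)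

lemma halfPlaneCutoff_nonneg (n : ℝ) (w : ℂ) : 0 ≤ halfPlaneCutoff n w :=
  mul_nonneg (Real.smoothTransition.nonneg _) (Real.smoothTransition.nonneg _)

lemma halfPlaneCutoff_le_one (n : ℝ) (w : ℂ) : halfPlaneCutoff n w ≤ 1 :=
  mul_le_one₀ (Real.smoothTransition.le_one _) (Real.smoothTransition.nonneg _)
    (Real.smoothTransition.le_one _)

lemma contDiff_halfPlaneCutoff (n : ℝ) : ContDiff ℝ 1 (halfPlaneCutoff n) := by
  have h : ContDiff ℝ 1 Real.smoothTransition := Real.smoothTransition.contDiff (n := 1)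
  refine ContDiff.mul (h.comp ?_) (h.comp ?_)
  · exact (contDiff_const.mul Complex.imCLM.contDiff).sub contDiff_const
  · exact contDiff_const.sub ((contDiff_norm_sq ℝ).div_const _)

lemma tsupport_halfPlaneCutoff_subset {n : ℝ} (hn : 0 < n) :
    tsupport (halfPlaneCutoff n) ⊆ {w | 1 ≤ n * w.im} ∩ Metric.closedBall 0 (2 * n) := by
  refine closure_minimal ?_ (IsClosed.inter ?_ Metric.isClosed_closedBall)
  · intro w hw
    rw [Function.mem_support, halfPlaneCutoff] at hw
    constructor
    · by_contra! h
      exact left_ne_zero_of_mul hw (Real.smoothTransition.zero_of_nonpos (by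
        simp only [mem_ofPred_eq, not_le] at h; linarith))
    · by_contra! h
      refine right_ne_zero_of_mul hw (Real.smoothTransition.zero_of_nonpos ?_)
      rw [mem_closedBall_zero_iff, not_le] at h
      have : 2 ≤ ‖w‖ ^ 2 / n ^ 2 := by
        rw [le_div_iff₀ (by positivity)]
        nlinarith
      linarith
  · exact isClosed_le continuous_const (continuous_const.mul Complex.continuous_im)

/-- The derivative of the cutoff function. -/
def halfPlaneCutoffDeriv (n : ℝ) (w : ℂ) : ℂ →L[ℝ] ℝ :=
  Real.smoothTransition (n * w.im - 1) •
      (deriv Real.smoothTransition (2 - ‖w‖ ^ 2 / n ^ 2) • (-(n ^ 2)⁻¹ • ((2 : ℝ) • innerSL ℝ w))) +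
    Real.smoothTransition (2 - ‖w‖ ^ 2 / n ^ 2) •
      (deriv Real.smoothTransition (n * w.im - 1) • (n • Complex.imCLM))

lemma hasFDerivAt_halfPlaneCutoff (n : ℝ) (w : ℂ) :
    HasFDerivAt (halfPlaneCutoff n) (halfPlaneCutoffDeriv n w) w := by
  have h : ∀ x, HasDerivAt Real.smoothTransition (deriv Real.smoothTransition x) x := fun x =>
    ((Real.smoothTransition.contDiff (n := 1)).differentiable (by simp) x).hasDerivAt
  have h1 : HasFDerivAt (fun w : ℂ => n * w.im - 1) (n • Complex.imCLM) w :=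
    (Complex.imCLM.hasFDerivAt.const_mul n).sub_const 1
  have h2 : HasFDerivAt (fun w : ℂ => 2 - ‖w‖ ^ 2 / n ^ 2)
      (-(n ^ 2)⁻¹ • ((2 : ℝ) • innerSL ℝ w)) w := by
    have h3 := ((hasStrictFDerivAt_norm_sq w).hasFDerivAt.const_mul ((n ^ 2)⁻¹)).const_sub 2
    refine (h3.congr_fderiv ?_).congr_of_eventuallyEq (Eventually.of_forall fun z => ?_)
    · ext v; simp [-mul_eq_mul_left_iff]; ring
    · simp only [div_eq_inv_mul]
  exact ((h _).comp_hasFDerivAt w h1).mul ((h _).comp_hasFDerivAt w h2)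

/-- This is the product rule `div (χ Y) = χ div Y + ∇χ · Y`, with the gradient term kept as `χ'`
applied to `Y w`. -/
lemma divergence_smul {χ : ℂ → ℝ} {Y : ℂ → ℂ} {χ' : ℂ →L[ℝ] ℝ} {w : ℂ}
    (hχ : HasFDerivAt χ χ' w) (hY : DifferentiableAt ℝ Y w) :
    divergence (fun z => χ z • Y z) w = χ w * divergence Y w + χ' (Y w) := by
  have h1 : Y w = (Y w).re • (1 : ℂ) + (Y w).im • Complex.I := by
    simp
  have h2 : χ' (Y w) = (Y w).re * χ' 1 + (Y w).im * χ' Complex.I := by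
    conv_lhs => rw [h1]
    rw [map_add, map_smul, map_smul, smul_eq_mul, smul_eq_mul]
  have h3 : HasFDerivAt (fun z => χ z • Y z) (χ w • fderiv ℝ Y w + χ'.smulRight (Y w)) w :=
    hχ.smul hY.hasFDerivAt
  rw [divergence_eq, divergence_eq, h3.fderiv, divergenceCLM_apply,
    divergenceCLM_apply, h2]
  simp
  ring

/-- The gradient term of a cut-off field is dominated, uniformly in the cutoff parameter. -/
lemma exists_abs_halfPlaneCutoffDeriv_le {C : ℝ} (hC : 0 ≤ C) :
    ∃ D : ℝ, 0 ≤ D ∧ ∀ n : ℝ, 1 ≤ n → ∀ w v : ℂ, 0 < w.im → ‖v‖ ≤ 1 →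
      |v.im| ≤ C * w.im / (1 + ‖w‖) → |halfPlaneCutoffDeriv n w v| ≤ D / (1 + ‖w‖) := by
  obtain ⟨M, hM0, hM⟩ := exists_abs_deriv_smoothTransition_le
  refine ⟨8 * M + 2 * M * C, by positivity, fun n hn w v hw hv hvi => ?_⟩
  have ha0 : ∀ x, |Real.smoothTransition x| ≤ 1 := fun x => by
    rw [abs_of_nonneg (Real.smoothTransition.nonneg _)]
    exact Real.smoothTransition.le_one _
  have hn0 : 0 < n := by linarith
  have e : halfPlaneCutoffDeriv n w v = Real.smoothTransition (n * w.im - 1) *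
      (deriv Real.smoothTransition (2 - ‖w‖ ^ 2 / n ^ 2) * (-(n ^ 2)⁻¹ * (2 * inner ℝ w v))) +
      Real.smoothTransition (2 - ‖w‖ ^ 2 / n ^ 2) *
        (deriv Real.smoothTransition (n * w.im - 1) * (n * v.im)) := by
    simp [halfPlaneCutoffDeriv]
  have hw0 : 0 < ‖w‖ := by
    rw [norm_pos_iff]; rintro rfl; simp at hw
  have h1 : |deriv Real.smoothTransition (2 - ‖w‖ ^ 2 / n ^ 2) *
      (-(n ^ 2)⁻¹ * (2 * inner ℝ w v))| ≤ 8 * M / (1 + ‖w‖) := by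
    -- The radial cutoff varies only where `n ≤ ‖w‖ ≤ √2 n`; there its gradient, of size `‖w‖ / n²`,
    -- is comparable to `1 / (1 + ‖w‖)`.
    by_cases h : n ^ 2 ≤ ‖w‖ ^ 2 ∧ ‖w‖ ^ 2 ≤ 2 * n ^ 2
    · have h2 : |inner ℝ w v| ≤ ‖w‖ := by
        refine (abs_real_inner_le_norm w v).trans ?_
        exact mul_le_of_le_one_right (norm_nonneg _) hv
      have h3 : 1 ≤ ‖w‖ := by
        have := abs_le_of_sq_le_sq' h.1 (norm_nonneg w)
        linarith [this.2]
      rw [abs_mul, abs_mul, abs_neg, abs_inv, abs_of_pos (by positivity : 0 < n ^ 2), abs_mul,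
        abs_two]
      calc _ ≤ M * ((n ^ 2)⁻¹ * (2 * ‖w‖)) := by
            gcongr
            exact hM _
        _ ≤ M * (8 / (1 + ‖w‖)) := by
            gcongr
            rw [inv_mul_eq_div, div_le_div_iff₀ (by positivity) (by positivity)]
            nlinarith [h.2]
        _ = _ := by ring
    · have h2 : deriv Real.smoothTransition (2 - ‖w‖ ^ 2 / n ^ 2) = 0 := by
        rw [not_and_or, not_le, not_le] at h
        rcases h with h | h
        · apply deriv_smoothTransition_of_one_lt
          have : ‖w‖ ^ 2 / n ^ 2 < 1 := by rw [div_lt_one (by positivity)]; exact h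
          linarith
        · apply deriv_smoothTransition_of_lt_zero
          have : 2 < ‖w‖ ^ 2 / n ^ 2 := by rw [lt_div_iff₀ (by positivity)]; exact h
          linarith
      rw [h2, zero_mul, abs_zero]
      positivity
  have h1' : |deriv Real.smoothTransition (n * w.im - 1) * (n * v.im)| ≤
      2 * M * C / (1 + ‖w‖) := by
    -- The cutoff near the axis varies only for `n * w.im ≤ 2`; there its slope `n` is compensated
    -- by the factor `w.im` in the bound on the normal component.
    by_cases h : n * w.im ≤ 2
    · rw [abs_mul, abs_mul, abs_of_pos hn0]
      calc _ ≤ M * (n * (C * w.im / (1 + ‖w‖))) := by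
            gcongr
            exact hM _
        _ = M * C * (n * w.im) / (1 + ‖w‖) := by ring
        _ ≤ M * C * 2 / (1 + ‖w‖) := by gcongr
        _ = _ := by ring
    · rw [deriv_smoothTransition_of_one_lt (by linarith), zero_mul, abs_zero]
      positivity
  rw [e, add_div]
  refine (abs_add_le _ _).trans (add_le_add ?_ ?_)
  · rw [abs_mul]
    exact (mul_le_of_le_one_left (abs_nonneg _) (ha0 _)).trans h1
  · rw [abs_mul]
    exact (mul_le_of_le_one_left (abs_nonneg _) (ha0 _)).trans h1'

/-- This gives the pointwise convergence for dominated convergence: at each fixed point the cut-off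
divergence eventually equals the original one. -/
lemma eventually_halfPlaneCutoff_eq_one {w : ℂ} (hw : 0 < w.im) :
    ∀ᶠ k : ℕ in atTop, halfPlaneCutoff ((k : ℝ) + 1) w = 1 ∧
      halfPlaneCutoffDeriv ((k : ℝ) + 1) w = 0 := by
  have ht : Tendsto (fun k : ℕ => (k : ℝ) + 1) atTop atTop :=
    tendsto_atTop_add_const_right _ _ tendsto_natCast_atTop_atTop
  filter_upwards [ht.eventually_gt_atTop (2 / w.im), ht.eventually_gt_atTop ‖w‖] with k h1 h2
  set n : ℝ := (k : ℝ) + 1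
  have hn : 0 < n := by positivity
  have h3 : 1 < n * w.im - 1 := by
    rw [div_lt_iff₀ hw] at h1; linarith
  have h4 : 1 < 2 - ‖w‖ ^ 2 / n ^ 2 := by
    have : ‖w‖ ^ 2 / n ^ 2 < 1 := by
      rw [div_lt_one (by positivity)]
      gcongr
    linarith
  constructor
  · rw [halfPlaneCutoff, Real.smoothTransition.one_of_one_le h3.le,
      Real.smoothTransition.one_of_one_le h4.le, one_mul]
  · rw [halfPlaneCutoffDeriv, deriv_smoothTransition_of_one_lt h3,
      deriv_smoothTransition_of_one_lt h4]
    simp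

/-! ### The isoperimetric inequality in the half plane -/

lemma continuous_divergence {X : ℂ → ℂ} (hX : ContDiff ℝ 1 X) : Continuous (divergence X) :=
  divergenceCLM.continuous.comp (hX.continuous_fderiv (by simp))

/-- A field that is tangential at the boundary of the half plane is as good as a test field. -/
lemma ofReal_setIntegral_divergence_le_weightedPerimeter {G : Set ℂ} (hGm : MeasurableSet G)
    (hG : G ⊆ upperHalf) (hGi : IntegrableOn (fun w : ℂ => 1 / (1 + ‖w‖)) G) {Y : ℂ → ℂ}
    (hY : ContDiff ℝ 1 Y) (hY1 : ∀ w, ‖Y w‖ ≤ 1) {C : ℝ} (hC : 0 ≤ C)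
    (hYi : ∀ w ∈ upperHalf, |(Y w).im| ≤ C * w.im / (1 + ‖w‖))
    (hYd : ∀ w ∈ upperHalf, |divergence Y w| ≤ C / (1 + ‖w‖)) :
    ENNReal.ofReal (∫ w in G, divergence Y w) ≤ weightedPerimeter upperHalf (fun _ => 1) G := by
  obtain ⟨D, hD0, hD⟩ := exists_abs_halfPlaneCutoffDeriv_le hC
  set X : ℕ → ℂ → ℂ := fun k w => halfPlaneCutoff ((k : ℝ) + 1) w • Y w with hX
  have hXc : ∀ k, ContDiff ℝ 1 (X k) := fun k => (contDiff_halfPlaneCutoff _).smul hY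
  have hdiv : ∀ k w, divergence (X k) w = halfPlaneCutoff ((k : ℝ) + 1) w * divergence Y w +
      halfPlaneCutoffDeriv ((k : ℝ) + 1) w (Y w) := fun k w =>
    divergence_smul (hasFDerivAt_halfPlaneCutoff _ _) (hY.differentiable (by simp) w)
  have htest : ∀ k, IsTestField upperHalf (fun _ => 1) (X k) := by
    intro k
    have hn : (0 : ℝ) < (k : ℝ) + 1 := by positivity
    have hs : tsupport (X k) ⊆ tsupport (halfPlaneCutoff ((k : ℝ) + 1)) :=
      tsupport_smul_subset_left _ _
    have hs' := hs.trans (tsupport_halfPlaneCutoff_subset hn)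
    refine ⟨hXc k, ?_, ?_, fun z => ?_⟩
    · exact (isCompact_closedBall (0 : ℂ) (2 * ((k : ℝ) + 1))).of_isClosed_subset
        (isClosed_tsupport _) (hs'.trans inter_subset_right)
    · intro w hw
      have h1 : 1 ≤ ((k : ℝ) + 1) * w.im := (hs' hw).1
      exact pos_of_mul_pos_right (one_pos.trans_le h1) hn.le
    · rw [hX, norm_smul, Real.norm_of_nonneg (halfPlaneCutoff_nonneg _ _)]
      exact mul_le_one₀ (halfPlaneCutoff_le_one _ _) (norm_nonneg _) (hY1 z)
  have hlim : Tendsto (fun k => ∫ w in G, divergence (X k) w) atTop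
      (𝓝 (∫ w in G, divergence Y w)) := by
    refine tendsto_integral_of_dominated_convergence (fun w => (C + D) * (1 / (1 + ‖w‖)))
      (fun k => (continuous_divergence (hXc k)).aestronglyMeasurable) (hGi.const_mul _)
      (fun k => ?_) ?_
    · refine (ae_restrict_mem hGm).mono fun w hw => ?_
      have hw' : 0 < w.im := hG hw
      rw [hdiv, Real.norm_eq_abs, mul_one_div, add_div]
      refine (abs_add_le _ _).trans (add_le_add ?_ ?_)
      · rw [abs_mul, abs_of_nonneg (halfPlaneCutoff_nonneg _ _)]
        exact (mul_le_of_le_one_left (abs_nonneg _) (halfPlaneCutoff_le_one _ _)).trans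
          (hYd w hw')
      · refine hD _ ?_ w (Y w) hw' (hY1 w) (hYi w hw')
        have : (0 : ℝ) ≤ k := k.cast_nonneg
        linarith
    · refine (ae_restrict_mem hGm).mono fun w hw => ?_
      refine tendsto_const_nhds.congr' ?_
      filter_upwards [eventually_halfPlaneCutoff_eq_one (hG hw)] with k hk
      rw [hdiv, hk.1, hk.2]
      simp
  refine le_of_tendsto ((ENNReal.continuous_ofReal.tendsto _).comp hlim)
    (Eventually.of_forall fun k => ?_)
  exact le_iSup₂_of_le (X k) (htest k) le_rfl

/-- The isoperimetric inequality in the half plane, with the perimeter of `G` bounded below by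
the area of its bounded parts. -/
lemma sqrt_two_pi_mul_le_weightedPerimeter_upperHalf {G F : Set ℂ} (hGm : MeasurableSet G)
    (hG : G ⊆ upperHalf) (hGi : IntegrableOn (fun w : ℂ => 1 / (1 + ‖w‖)) G)
    (hFm : MeasurableSet F) (hFG : F ⊆ G) {N : ℝ} (hN : ∀ y ∈ F, ‖y‖ ≤ N) :
    ENNReal.ofReal (√(2 * Real.pi * (volume F).toReal)) ≤
      weightedPerimeter upperHalf (fun _ => 1) G := by
  have hF : volume F ≠ ⊤ := ne_top_of_le_ne_top
    (measure_closedBall_lt_top (x := (0 : ℂ)) (r := N)).ne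
    (measure_mono fun y hy => by simpa using hN y hy)
  rcases eq_or_ne (volume F) 0 with h0 | h0
  · simp [h0]
  set F' := F ∪ (starRingEnd ℂ : ℂ → ℂ) ⁻¹' F with hF'def
  have hcm : MeasurableSet ((starRingEnd ℂ : ℂ → ℂ) ⁻¹' F) := measurePreserving_conj.measurable hFm
  have hvol : volume F' = 2 * volume F := by
    rw [hF'def, measure_union _ hcm, measurePreserving_conj.measure_preimage hFm.nullMeasurableSet,
      two_mul]
    rw [Set.disjoint_left]
    intro y hy hy'
    have h1 : 0 < y.im := hG (hFG hy)
    have h2 : 0 < ((starRingEnd ℂ) y).im := hG (hFG hy')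
    rw [Complex.conj_im] at h2
    linarith
  have hF' : volume F' ≠ ⊤ := by rw [hvol]; exact ENNReal.mul_ne_top (by simp) hF
  have hN' : ∀ y ∈ F', ‖y‖ ≤ N := by
    rintro y (hy | hy)
    · exact hN y hy
    · rw [← RCLike.norm_conj]; exact hN _ hy
  have hconj : (starRingEnd ℂ : ℂ → ℂ) ⁻¹' F' = F' := by
    rw [hF'def, preimage_union, ← preimage_comp, union_comm]
    congr 1
    ext y
    simp
  set m := (volume F).toReal with hm
  have hm0 : 0 < m := ENNReal.toReal_pos h0 hF
  have hs' : Real.pi * (volume F').toReal = 2 * Real.pi * m := by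
    rw [hvol, ENNReal.toReal_mul, ENNReal.toReal_ofNat]; ring
  set s := √(2 * Real.pi * m) with hs
  have hs0 : 0 < s := Real.sqrt_pos.2 (by positivity)
  have hss : s * s = 2 * Real.pi * m := Real.mul_self_sqrt (by positivity)
  -- The factor `t ^ 2` is the loss in the approximate identity at a suitable `δ`; it is removed at
  -- the end by letting `t` tend to `1`.
  have key : ∀ t : ℝ, 0 < t → t < 1 →
      ENNReal.ofReal (t ^ 2 * s) ≤ weightedPerimeter upperHalf (fun _ => 1) G := by
    intro t ht0 ht1
    obtain ⟨δ, hδ, h1⟩ := exists_le_lintegral_lintegral_newtonDensity hFm hF ht0 ht1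
    obtain ⟨C₁, hC₁, him⟩ := exists_abs_newtonField_im_le hδ hF' hN' hconj
    obtain ⟨C₂, hC₂, hdv⟩ := exists_divergence_newtonField_le hδ hF' hN'
    -- The quadratic decay of the field estimates is weakened to the weight `1 / (1 + ‖w‖)`, the
    -- only one assumed integrable over `G`.
    have hsq : ∀ w : ℂ, (1 + ‖w‖ ^ 2)⁻¹ ≤ 2 * (1 + ‖w‖)⁻¹ := fun w => by
      rw [inv_eq_one_div, ← div_eq_mul_inv, div_le_div_iff₀ (by positivity) (by positivity)]
      nlinarith [sq_nonneg (2 * ‖w‖ - 1)]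
    have hYc := contDiff_newtonField hδ hF'
    have hdivY : ∀ w, divergence (fun z => s⁻¹ • newtonField δ F' z) w =
        s⁻¹ * divergence (newtonField δ F') w := fun w => by
      rw [divergence_smul (hasFDerivAt_const s⁻¹ w) (hYc.differentiable (by simp) w)]
      simp
    have h2 := ofReal_setIntegral_divergence_le_weightedPerimeter hGm hG hGi
      (Y := fun w => s⁻¹ • newtonField δ F' w) (C := s⁻¹ * (2 * (C₁ + C₂)))
      (hYc.const_smul s⁻¹) (fun w => ?_) (by positivity) (fun w hw => ?_) (fun w hw => ?_)
    · refine le_trans ?_ h2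
      simp_rw [hdivY]
      have hnn : ∀ w, 0 ≤ divergence (newtonField δ F') w := fun w => by
        rw [divergence_newtonField hδ hF']
        exact integral_nonneg fun y => newtonDensity_nonneg _ _
      have hint : IntegrableOn (divergence (newtonField δ F')) G := by
        refine (hGi.const_mul (C₂ * 2)).mono'
          (continuous_divergence hYc).aestronglyMeasurable (Eventually.of_forall fun w => ?_)
        refine (hdv w).trans ?_
        rw [div_eq_mul_inv, one_div, mul_assoc]
        exact mul_le_mul_of_nonneg_left (hsq w) hC₂
      have h3 : ENNReal.ofReal (t ^ 2 * (2 * Real.pi) * m) ≤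
          ENNReal.ofReal (∫ w in G, divergence (newtonField δ F') w) := by
        rw [ofReal_integral_eq_lintegral_ofReal hint (Eventually.of_forall hnn),
          ENNReal.ofReal_mul (by positivity), hm, ENNReal.ofReal_toReal hF]
        -- Since the density is nonnegative, the double integral over `F × F` is at most the one
        -- over `G × F'`.
        refine h1.trans ((lintegral_mono fun w => ?_).trans (lintegral_mono_set hFG))
        rw [divergence_newtonField hδ hF', ofReal_integral_eq_lintegral_ofReal _
          (Eventually.of_forall fun y => newtonDensity_nonneg _ _)]
        · exact lintegral_mono_set subset_union_left
        · refine integrableOn_of_norm_le (C := 2 / δ ^ 2) hF'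
            ((continuous_newtonDensity hδ).comp (continuous_sub_left w)) fun y => ?_
          rw [Real.norm_of_nonneg (newtonDensity_nonneg _ _)]
          exact newtonDensity_le hδ _
      rw [integral_const_mul]
      refine le_trans (ENNReal.ofReal_le_ofReal ?_) (le_refl _)
      rw [ENNReal.ofReal_le_ofReal_iff (integral_nonneg hnn)] at h3
      rw [inv_mul_eq_div, le_div_iff₀ hs0, mul_assoc, hss]
      linarith
    · rw [norm_smul, norm_inv, Real.norm_of_nonneg hs0.le, inv_mul_eq_div, div_le_one hs0, hs, ← hs']
      exact norm_newtonField_le hδ hF' w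
    · have hw' : 0 < w.im := hw
      rw [Complex.smul_im, smul_eq_mul, abs_mul, abs_of_pos (by positivity : 0 < s⁻¹)]
      calc s⁻¹ * |(newtonField δ F' w).im| ≤ s⁻¹ * (C₁ * w.im / (1 + ‖w‖ ^ 2)) := by
            gcongr; exact him w hw'.le
        _ = s⁻¹ * (C₁ * w.im) * (1 + ‖w‖ ^ 2)⁻¹ := by ring
        _ ≤ s⁻¹ * ((C₁ + C₂) * w.im) * (2 * (1 + ‖w‖)⁻¹) := by
            gcongr
            · linarith
            · exact hsq w
        _ = _ := by ring
    · rw [hdivY, abs_mul, abs_of_pos (by positivity : 0 < s⁻¹)]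
      calc s⁻¹ * |divergence (newtonField δ F') w| ≤ s⁻¹ * (C₂ / (1 + ‖w‖ ^ 2)) := by
            gcongr; exact hdv w
        _ = s⁻¹ * C₂ * (1 + ‖w‖ ^ 2)⁻¹ := by ring
        _ ≤ s⁻¹ * (C₁ + C₂) * (2 * (1 + ‖w‖)⁻¹) := by
            gcongr
            · linarith
            · exact hsq w
        _ = _ := by ring
  have hlim : Tendsto (fun t : ℝ => ENNReal.ofReal (t ^ 2 * s)) (𝓝[<] 1)
      (𝓝 (ENNReal.ofReal (1 ^ 2 * s))) := by
    refine (ENNReal.continuous_ofReal.tendsto _).comp (Tendsto.mono_left ?_ nhdsWithin_le_nhds)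
    exact Continuous.tendsto (by fun_prop) 1
  rw [one_pow, one_mul] at hlim
  refine le_of_tendsto hlim ?_
  filter_upwards [Ioo_mem_nhdsLT (zero_lt_one (α := ℝ))] with t ht
  exact key t ht.1 ht.2

/-! ### The sector and its conformal map onto the half plane -/

lemma sector_eq {θ₀ : ℝ} (h : θ₀ ≤ Real.pi) :
    sector θ₀ = {z : ℂ | 0 < z.arg ∧ z.arg < θ₀} := by
  ext z
  constructor
  · rintro ⟨r, θ, hr, h0, h1, rfl⟩
    rw [mem_ofPred_eq, Complex.exp_mul_I, Complex.arg_mul_cos_add_sin_mul_I hr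
      ⟨by linarith [Real.pi_pos], by linarith⟩]
    exact ⟨h0, h1⟩
  · rintro ⟨h0, h1⟩
    refine ⟨‖z‖, z.arg, ?_, h0, h1, (Complex.norm_mul_exp_arg_mul_I z).symm⟩
    rw [norm_pos_iff]
    rintro rfl
    simp at h0

lemma sector_subset_slitPlane {θ₀ : ℝ} (h : θ₀ ≤ Real.pi) :
    sector θ₀ ⊆ Complex.slitPlane := by
  rw [sector_eq h]
  rintro z ⟨h0, h1⟩
  rw [Complex.mem_slitPlane_iff_arg]
  refine ⟨by linarith, ?_⟩
  rintro rfl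
  simp at h0

lemma isOpen_sector {θ₀ : ℝ} (h : θ₀ ≤ Real.pi) : IsOpen (sector θ₀) := by
  have h1 : sector θ₀ = Complex.slitPlane ∩ Complex.arg ⁻¹' Ioo 0 θ₀ := by
    refine Subset.antisymm (fun z hz => ⟨sector_subset_slitPlane h hz, ?_⟩) fun z hz => ?_
    · rw [sector_eq h] at hz; exact hz
    · rw [sector_eq h]; exact hz.2
  rw [h1]
  refine ContinuousOn.isOpen_inter_preimage ?_ Complex.isOpen_slitPlane isOpen_Ioo
  exact fun z hz => (Complex.continuousAt_arg hz).continuousWithinAt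

lemma sector_angle_lt_pi {p : ℝ} (hp : 0 < p) : Real.pi / (p + 1) < Real.pi := by
  rw [div_lt_iff₀ (by linarith)]
  nlinarith [Real.pi_pos]

/-- The conformal map `z ^ (p + 1) / (p + 1)` of the `π / (p + 1)`-sector onto the upper half
plane, with derivative `z ^ p`. -/
def sectorMap (p : ℝ) (z : ℂ) : ℂ := z ^ ((p + 1 : ℝ) : ℂ) / ((p + 1 : ℝ) : ℂ)

/-- The inverse of `sectorMap`. -/
def sectorMapInv (p : ℝ) (w : ℂ) : ℂ := (((p + 1 : ℝ) : ℂ) * w) ^ (((p + 1)⁻¹ : ℝ) : ℂ)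

lemma cpow_ofReal_eq {z : ℂ} (hz : z ≠ 0) (c : ℝ) :
    z ^ (c : ℂ) = (Real.exp (Real.log ‖z‖ * c) : ℝ) *
      Complex.exp (((c * z.arg : ℝ) : ℂ) * Complex.I) := by
  rw [Complex.cpow_def_of_ne_zero hz, Complex.log, Complex.ofReal_exp, ← Complex.exp_add]
  congr 1
  push_cast
  ring

lemma sectorMap_mem {p : ℝ} (hp : 0 < p) {z : ℂ} (hz : z ∈ sector (Real.pi / (p + 1))) :
    sectorMap p z ∈ upperHalf := by
  have hz0 := Complex.slitPlane_ne_zero (sector_subset_slitPlane (sector_angle_lt_pi hp).le hz)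
  rw [sector_eq (sector_angle_lt_pi hp).le] at hz
  have hp1 : 0 < p + 1 := by linarith
  change 0 < (sectorMap p z).im
  rw [sectorMap, Complex.div_ofReal_im, cpow_ofReal_eq hz0, Complex.im_ofReal_mul,
    Complex.exp_ofReal_mul_I_im]
  have h1 := hz.2
  rw [lt_div_iff₀ hp1] at h1
  have := Real.sin_pos_of_pos_of_lt_pi (mul_pos hp1 hz.1) (by linarith)
  positivity

lemma sectorMapInv_mem {p : ℝ} (hp : 0 < p) {w : ℂ} (hw : w ∈ upperHalf) :
    sectorMapInv p w ∈ sector (Real.pi / (p + 1)) := by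
  have hp1 : 0 < p + 1 := by linarith
  have hw' : 0 < w.im := hw
  have hw0 : w ≠ 0 := by rintro rfl; simp at hw'
  have h0 : ((p + 1 : ℝ) : ℂ) * w ≠ 0 := mul_ne_zero (by exact_mod_cast hp1.ne') hw0
  have harg : (((p + 1 : ℝ) : ℂ) * w).arg = w.arg := Complex.arg_real_mul _ hp1
  have h1 : 0 < w.arg := lt_of_le_of_ne (Complex.arg_nonneg_iff.2 hw'.le) fun h =>
    hw'.ne (Complex.arg_eq_zero_iff.1 h.symm).2.symm
  have h2 : w.arg < Real.pi := Complex.arg_lt_pi_iff.2 (Or.inr hw'.ne')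
  rw [sectorMapInv, cpow_ofReal_eq h0, harg]
  refine ⟨_, _, Real.exp_pos _, by positivity, ?_, rfl⟩
  rw [inv_mul_eq_div]
  gcongr

/-- The principal powers are inverse to each other because `(p + 1) * arg z` stays between `0` and
`π`, inside the principal range. -/
lemma sectorMapInv_sectorMap {p : ℝ} (hp : 0 < p) {z : ℂ}
    (hz : z ∈ sector (Real.pi / (p + 1))) : sectorMapInv p (sectorMap p z) = z := by
  have hp1 : 0 < p + 1 := by linarith
  have hp1' : ((p + 1 : ℝ) : ℂ) ≠ 0 := by exact_mod_cast hp1.ne'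
  rw [sector_eq (sector_angle_lt_pi hp).le] at hz
  have h1 := hz.2
  rw [lt_div_iff₀ hp1] at h1
  have h2 : 0 < z.arg * (p + 1) := mul_pos hz.1 hp1
  rw [sectorMapInv, sectorMap, mul_div_cancel₀ _ hp1', ← Complex.cpow_mul]
  · rw [Complex.ofReal_inv, mul_inv_cancel₀ hp1', Complex.cpow_one]
  · rw [Complex.im_mul_ofReal, Complex.log_im]
    linarith [Real.pi_pos]
  · rw [Complex.im_mul_ofReal, Complex.log_im]
    linarith

lemma injOn_sectorMap {p : ℝ} (hp : 0 < p) : InjOn (sectorMap p) (sector (Real.pi / (p + 1))) :=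
  fun x hx y hy h => by
    rw [← sectorMapInv_sectorMap hp hx, h, sectorMapInv_sectorMap hp hy]

lemma continuousOn_sectorMapInv {p : ℝ} (hp : 0 < p) : ContinuousOn (sectorMapInv p) upperHalf := by
  intro w hw
  have hp1 : 0 < p + 1 := by linarith
  have hs : ((p + 1 : ℝ) : ℂ) * w ∈ Complex.slitPlane := by
    refine Complex.mem_slitPlane_iff.2 (Or.inr ?_)
    rw [Complex.im_ofReal_mul]
    exact (mul_pos hp1 hw).ne'
  have h1 : ContinuousAt (fun w : ℂ => ((p + 1 : ℝ) : ℂ) * w) w := by fun_prop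
  exact (ContinuousAt.comp (f := fun w : ℂ => ((p + 1 : ℝ) : ℂ) * w)
    (continuousAt_cpow_const hs) h1).continuousWithinAt

lemma hasDerivAt_sectorMap {p : ℝ} (hp : 0 < p) {z : ℂ} (hz : z ∈ Complex.slitPlane) :
    HasDerivAt (sectorMap p) (z ^ (p : ℂ)) z := by
  have hp1 : ((p + 1 : ℝ) : ℂ) ≠ 0 := by
    have : p + 1 ≠ 0 := by linarith
    exact_mod_cast this
  have h := ((hasDerivAt_id z).cpow_const (c := ((p + 1 : ℝ) : ℂ)) hz).div_const ((p + 1 : ℝ) : ℂ)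
  convert! h using 1
  rw [id, mul_one, mul_div_cancel_left₀ _ hp1]
  congr 1
  push_cast
  ring

lemma analyticAt_cpow_const {z : ℂ} (hz : z ∈ Complex.slitPlane) (c : ℂ) :
    AnalyticAt ℂ (fun z => z ^ c) z :=
  analyticAt_id.cpow analyticAt_const hz

/-! ### Transport of fields, perimeter and area -/

/-- The divergence of the Piola transform of a field under a conformal map `g` with `g' = h`. -/
lemma divergence_conformal_pullback {g h Y : ℂ → ℂ} {h' z : ℂ} (hg : HasDerivAt g (h z) z)
    (hh : HasDerivAt h h' z) (hY : DifferentiableAt ℝ Y (g z)) :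
    divergence (fun z => (starRingEnd ℂ) (h z) * Y (g z)) z =
      ‖h z‖ ^ 2 * divergence Y (g z) := by
  have h1 : HasFDerivAt (fun z => (starRingEnd ℂ) (h z))
      ((Complex.conjCLE : ℂ →L[ℝ] ℂ).comp (h' • (1 : ℂ →L[ℝ] ℂ))) z :=
    (Complex.conjCLE : ℂ →L[ℝ] ℂ).hasFDerivAt.comp z hh.complexToReal_fderiv
  have h2 : HasFDerivAt (fun z => Y (g z))
      ((fderiv ℝ Y (g z)).comp (h z • (1 : ℂ →L[ℝ] ℂ))) z :=
    hY.hasFDerivAt.comp z hg.complexToReal_fderiv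
  have h3 : HasFDerivAt (fun z => (starRingEnd ℂ) (h z) * Y (g z)) _ z := h1.mul h2
  rw [divergence_eq, divergence_eq, h3.fderiv, divergenceCLM_apply, divergenceCLM_apply]
  set L := fderiv ℝ Y (g z)
  have hL : ∀ v : ℂ, L v = v.re • L 1 + v.im • L Complex.I := by
    intro v
    conv_lhs => rw [show v = v.re • (1 : ℂ) + v.im • Complex.I by simp]
    rw [map_add, map_smul, map_smul]
  have e : ‖h z‖ ^ 2 = (h z).re ^ 2 + (h z).im ^ 2 := by
    rw [← Complex.normSq_eq_norm_sq, Complex.normSq_apply]; ring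
  simp only [_root_.add_apply, _root_.smul_apply,
    ContinuousLinearMap.comp_apply, one_apply_eq_self, smul_eq_mul, mul_one,
    ContinuousLinearEquiv.coe_coe, Complex.conjCLE_apply]
  rw [hL (h z), hL (h z * Complex.I), e]
  simp
  ring

/-- The determinant of multiplication by `c` is the algebra norm of `ℂ` over `ℝ`. -/
lemma det_smul_one (c : ℂ) : (c • (1 : ℂ →L[ℝ] ℂ)).det = ‖c‖ ^ 2 := by
  rw [← Complex.normSq_eq_norm_sq, ← Algebra.norm_complex_apply, Algebra.norm_apply]
  rfl

/-- The pullback of a field under `sectorMap`. -/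
def sectorPullback (p : ℝ) (Y : ℂ → ℂ) : ℂ → ℂ :=
  (sector (Real.pi / (p + 1))).indicator
    fun z => (starRingEnd ℂ) (z ^ (p : ℂ)) * Y (sectorMap p z)

/-- The factor `conj (z ^ p)` has modulus `‖z‖ ^ p`, which turns the bound `1` into the density. The
support stays compact inside the open sector because it lies in the image of `tsupport Y` under the
continuous inverse map; hence extension by zero is smooth enough. -/
lemma isTestField_sectorPullback {p : ℝ} (hp : 0 < p) {Y : ℂ → ℂ}
    (hY : IsTestField upperHalf (fun _ => 1) Y) :
    IsTestField (sector (Real.pi / (p + 1))) (powDensity p) (sectorPullback p Y) := by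
  set S := sector (Real.pi / (p + 1)) with hS
  have hK : IsCompact (sectorMapInv p '' tsupport Y) :=
    hY.hasCompactSupport.isCompact.image_of_continuousOn
      ((continuousOn_sectorMapInv hp).mono hY.tsupport_subset)
  have hKS : sectorMapInv p '' tsupport Y ⊆ S := by
    rintro _ ⟨w, hw, rfl⟩
    exact sectorMapInv_mem hp (hY.tsupport_subset hw)
  have hsupp : Function.support (sectorPullback p Y) ⊆ sectorMapInv p '' tsupport Y := by
    intro z hz
    have hzS : z ∈ S := by
      by_contra h
      exact hz (indicator_of_notMem h _)
    refine ⟨sectorMap p z, subset_tsupport _ fun h => hz ?_, sectorMapInv_sectorMap hp hzS⟩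
    rw [sectorPullback, indicator_of_mem hzS, h, mul_zero]
  have hts : tsupport (sectorPullback p Y) ⊆ sectorMapInv p '' tsupport Y :=
    closure_minimal hsupp hK.isClosed
  refine ⟨contDiff_iff_contDiffAt.2 fun z => ?_, hK.of_isClosed_subset (isClosed_tsupport _) hts,
    hts.trans hKS, fun z => ?_⟩
  · by_cases hz : z ∈ S
    · have hzs := sector_subset_slitPlane (sector_angle_lt_pi hp).le hz
      have h1 : ContDiffAt ℝ 1 (fun z : ℂ => z ^ (p : ℂ)) z :=
        (analyticAt_cpow_const hzs _).contDiffAt.restrict_scalars ℝ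
      have h2 : ContDiffAt ℝ 1 (sectorMap p) z :=
        ((analyticAt_cpow_const hzs _).contDiffAt.restrict_scalars ℝ).div_const _
      have h3 : ContDiffAt ℝ 1 (fun z : ℂ => (starRingEnd ℂ) (z ^ (p : ℂ))) z :=
        (Complex.conjCLE : ℂ →L[ℝ] ℂ).contDiff.contDiffAt.comp z h1
      refine (h3.mul (hY.contDiff.contDiffAt.comp z h2)).congr_of_eventuallyEq ?_
      filter_upwards [(isOpen_sector (sector_angle_lt_pi hp).le).mem_nhds hz] with y hy
      exact indicator_of_mem hy _
    · have hz' : z ∉ tsupport (sectorPullback p Y) := fun h => hz (hKS (hts h))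
      refine (contDiffAt_const (c := (0 : ℂ))).congr_of_eventuallyEq ?_
      exact notMem_tsupport_iff_eventuallyEq.1 hz'
  · by_cases hz : z ∈ S
    · rw [sectorPullback, indicator_of_mem hz, norm_mul, RCLike.norm_conj, Complex.norm_cpow_real,
        powDensity]
      exact mul_le_of_le_one_right (by positivity) (hY.norm_le _)
    · rw [sectorPullback, indicator_of_notMem hz, norm_zero, powDensity]
      positivity

lemma hasFDerivWithinAt_sectorMap {p : ℝ} (hp : 0 < p) {E : Set ℂ}
    (hE : E ⊆ sector (Real.pi / (p + 1))) :
    ∀ z ∈ E, HasFDerivWithinAt (sectorMap p) (z ^ (p : ℂ) • (1 : ℂ →L[ℝ] ℂ)) E z := fun _ hz =>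
  (hasDerivAt_sectorMap hp (sector_subset_slitPlane (sector_angle_lt_pi hp).le
    (hE hz))).complexToReal_fderiv.hasFDerivWithinAt

lemma abs_det_sectorMap (p : ℝ) (z : ℂ) :
    |(z ^ (p : ℂ) • (1 : ℂ →L[ℝ] ℂ)).det| = (‖z‖ ^ p) ^ 2 := by
  rw [det_smul_one, Complex.norm_cpow_real, abs_of_nonneg (by positivity)]

lemma measurableSet_sectorMap_image {p : ℝ} (hp : 0 < p) {E : Set ℂ} (hEm : MeasurableSet E)
    (hE : E ⊆ sector (Real.pi / (p + 1))) : MeasurableSet (sectorMap p '' E) :=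
  measurable_image_of_fderivWithin hEm (hasFDerivWithinAt_sectorMap hp hE)
    ((injOn_sectorMap hp).mono hE)

/-- The perimeter in the sector with density `r ^ p` dominates the Euclidean perimeter of the
conformal image in the half plane. -/
lemma weightedPerimeter_sectorMap_image_le {p : ℝ} (hp : 0 < p) {E : Set ℂ}
    (hEm : MeasurableSet E) (hE : E ⊆ sector (Real.pi / (p + 1))) :
    weightedPerimeter upperHalf (fun _ => 1) (sectorMap p '' E) ≤
      weightedPerimeter (sector (Real.pi / (p + 1))) (powDensity p) E := by
  refine iSup₂_le fun Y hY => le_iSup₂_of_le _ (isTestField_sectorPullback hp hY)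
    (le_of_eq (congrArg ENNReal.ofReal ?_))
  rw [integral_image_eq_integral_abs_det_fderiv_smul volume hEm (hasFDerivWithinAt_sectorMap hp hE)
    ((injOn_sectorMap hp).mono hE)]
  refine setIntegral_congr_fun hEm fun z hz => ?_
  have hzS := hE hz
  have hzs := sector_subset_slitPlane (sector_angle_lt_pi hp).le hzS
  have h1 : divergence (sectorPullback p Y) z =
      divergence (fun z => (starRingEnd ℂ) (z ^ (p : ℂ)) * Y (sectorMap p z)) z := by
    have : sectorPullback p Y =ᶠ[𝓝 z]
        fun z => (starRingEnd ℂ) (z ^ (p : ℂ)) * Y (sectorMap p z) := by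
      filter_upwards [(isOpen_sector (sector_angle_lt_pi hp).le).mem_nhds hzS] with y hy
      exact indicator_of_mem hy _
    rw [divergence_eq, divergence_eq, this.fderiv_eq]
  simp only [abs_det_sectorMap, smul_eq_mul]
  rw [h1, divergence_conformal_pullback (h := fun z => z ^ (p : ℂ)) (hasDerivAt_sectorMap hp hzs)
    (analyticAt_cpow_const hzs _).differentiableAt.hasDerivAt
    (hY.contDiff.differentiable (by simp) _), Complex.norm_cpow_real]

/-- The Euclidean area of the conformal image of `E` in the half plane. -/
def conformalArea (p : ℝ) (E : Set ℂ) : ENNReal := ∫⁻ z in E, ENNReal.ofReal ((‖z‖ ^ p) ^ 2)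

lemma measurable_rpow_norm (p : ℝ) : Measurable fun z : ℂ => ‖z‖ ^ p := by fun_prop

lemma volume_sectorMap_image {p : ℝ} (hp : 0 < p) {E : Set ℂ} (hEm : MeasurableSet E)
    (hE : E ⊆ sector (Real.pi / (p + 1))) : volume (sectorMap p '' E) = conformalArea p E := by
  rw [← lintegral_abs_det_fderiv_eq_addHaar_image volume hEm (hasFDerivWithinAt_sectorMap hp hE)
    ((injOn_sectorMap hp).mono hE), conformalArea]
  simp_rw [abs_det_sectorMap]

lemma norm_sectorMap {p : ℝ} (hp : 0 < p) (z : ℂ) :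
    ‖sectorMap p z‖ = ‖z‖ ^ (p + 1) / (p + 1) := by
  rw [sectorMap, norm_div, Complex.norm_cpow_real, Complex.norm_real,
    Real.norm_of_nonneg (by linarith)]

/-- The image may a priori have infinite area, and this is the integrability that finite weighted
area provides. After the change of variables the integrand is `‖z‖ ^ (2 p) / (1 + ‖z‖ ^ (p + 1) / (p
+ 1))`, at most `(p + 1) * ‖z‖ ^ p`. -/
lemma integrableOn_sectorMap_image {p : ℝ} (hp : 0 < p) {E : Set ℂ} (hEm : MeasurableSet E)
    (hE : E ⊆ sector (Real.pi / (p + 1))) (hA : weightedArea (powDensity p) E ≠ ⊤) :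
    IntegrableOn (fun w : ℂ => 1 / (1 + ‖w‖)) (sectorMap p '' E) := by
  rw [integrableOn_image_iff_integrableOn_abs_det_fderiv_smul volume hEm
    (hasFDerivWithinAt_sectorMap hp hE) ((injOn_sectorMap hp).mono hE)]
  have h1 : IntegrableOn (fun z : ℂ => (p + 1) * ‖z‖ ^ p) E := by
    refine Integrable.const_mul ⟨(measurable_rpow_norm p).aestronglyMeasurable, ?_⟩ _
    rw [hasFiniteIntegral_iff_ofReal (Eventually.of_forall fun z => by positivity)]
    exact hA.lt_top
  refine h1.mono' ?_ (Eventually.of_forall fun z => ?_)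
  · simp_rw [abs_det_sectorMap, norm_sectorMap hp]
    exact Measurable.aestronglyMeasurable (by fun_prop)
  · rw [abs_det_sectorMap, norm_sectorMap hp, smul_eq_mul, Real.norm_of_nonneg (by positivity),
      mul_one_div, div_le_iff₀ (by positivity)]
    have h2 : ‖z‖ ^ p ≤ 1 + ‖z‖ ^ (p + 1) := by
      rcases le_total ‖z‖ 1 with h | h
      · have := Real.rpow_le_one (norm_nonneg z) h hp.le
        have := Real.rpow_nonneg (norm_nonneg z) (p + 1)
        linarith
      · have := Real.rpow_le_rpow_of_exponent_le h (by linarith : p ≤ p + 1)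
        linarith
    have h3 : (p + 1) * (1 + ‖z‖ ^ (p + 1) / (p + 1)) = p + 1 + ‖z‖ ^ (p + 1) := by
      field_simp
    have h4 := Real.rpow_nonneg (norm_nonneg z) p
    calc (‖z‖ ^ p) ^ 2 ≤ ‖z‖ ^ p * (p + 1 + ‖z‖ ^ (p + 1)) := by
          rw [sq]; gcongr; linarith
      _ = _ := by rw [← h3]; ring

/-- The isoperimetric inequality in the sector in terms of the conformal area. -/
lemma conformalArea_le_of_weightedPerimeter_le {p : ℝ} (hp : 0 < p) {E : Set ℂ}
    (hEm : MeasurableSet E) (hE : E ⊆ sector (Real.pi / (p + 1)))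
    (hA : weightedArea (powDensity p) E ≠ ⊤) {Q : ℝ} (hQ : 0 ≤ Q)
    (hP : weightedPerimeter (sector (Real.pi / (p + 1))) (powDensity p) E ≤ ENNReal.ofReal Q) :
    conformalArea p E ≤ ENNReal.ofReal (Q ^ 2 / (2 * Real.pi)) := by
  -- The half-plane inequality sees only bounded parts; exhausting `E` by balls then shows that the
  -- whole conformal area is finite.
  have h1 : ∀ N : ℕ, conformalArea p (E ∩ Metric.closedBall 0 N) ≤
      ENNReal.ofReal (Q ^ 2 / (2 * Real.pi)) := by
    intro N
    have hm : MeasurableSet (E ∩ Metric.closedBall 0 N) :=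
      hEm.inter Metric.isClosed_closedBall.measurableSet
    have hs : E ∩ Metric.closedBall 0 N ⊆ sector (Real.pi / (p + 1)) :=
      inter_subset_left.trans hE
    have hb : ∀ y ∈ sectorMap p '' (E ∩ Metric.closedBall 0 N),
        ‖y‖ ≤ (N : ℝ) ^ (p + 1) / (p + 1) := by
      rintro _ ⟨z, hz, rfl⟩
      rw [norm_sectorMap hp]
      have : ‖z‖ ≤ N := by simpa using hz.2
      gcongr
    have h2 := sqrt_two_pi_mul_le_weightedPerimeter_upperHalf
      (measurableSet_sectorMap_image hp hEm hE)
      (by rintro _ ⟨z, hz, rfl⟩; exact sectorMap_mem hp (hE hz))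
      (integrableOn_sectorMap_image hp hEm hE hA) (measurableSet_sectorMap_image hp hm hs)
      (image_mono inter_subset_left) hb
    have h3 := (h2.trans (weightedPerimeter_sectorMap_image_le hp hEm hE)).trans hP
    have hfin : volume (sectorMap p '' (E ∩ Metric.closedBall 0 N)) ≠ ⊤ :=
      ne_top_of_le_ne_top
        (measure_closedBall_lt_top (x := (0 : ℂ)) (r := (N : ℝ) ^ (p + 1) / (p + 1))).ne
        (measure_mono fun y hy => by simpa using hb y hy)
    rw [ENNReal.ofReal_le_ofReal_iff hQ, Real.sqrt_le_left hQ] at h3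
    rw [← volume_sectorMap_image hp hm hs, ENNReal.le_ofReal_iff_toReal_le hfin (by positivity),
      le_div_iff₀ (by positivity)]
    linarith
  have h2 : E = ⋃ N : ℕ, E ∩ Metric.closedBall 0 N := by
    rw [← inter_iUnion, Metric.iUnion_closedBall_nat, inter_univ]
  rw [h2, conformalArea, setLIntegral_iUnion_of_directed]
  · exact iSup_le h1
  · refine Monotone.directed_le fun i j hij => inter_subset_inter_right _ ?_
    exact Metric.closedBall_subset_closedBall (by exact_mod_cast hij)

/-! ### Perimeter and area of the disc sector -/

/-- Polar coordinates as a map into `ℂ`. -/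
def polarMap (q : ℝ × ℝ) : ℂ := q.1 * (Real.cos q.2 + Real.sin q.2 * Complex.I)

lemma contDiff_polarMap : ContDiff ℝ 1 polarMap := by
  have h : ContDiff ℝ 1 (Complex.ofReal) := Complex.ofRealCLM.contDiff
  exact (h.comp contDiff_fst).mul (((h.comp (Real.contDiff_cos.comp contDiff_snd))).add
    ((h.comp (Real.contDiff_sin.comp contDiff_snd)).mul contDiff_const))

/-- `r` times the radial component of a field, in polar coordinates. -/
def polarRadial (X : ℂ → ℂ) (q : ℝ × ℝ) : ℝ :=
  q.1 * ((X (polarMap q)).re * Real.cos q.2 + (X (polarMap q)).im * Real.sin q.2)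

/-- The angular component of a field, in polar coordinates. -/
def polarAngular (X : ℂ → ℂ) (q : ℝ × ℝ) : ℝ :=
  (X (polarMap q)).im * Real.cos q.2 - (X (polarMap q)).re * Real.sin q.2

lemma contDiff_polarRadial {X : ℂ → ℂ} (hX : ContDiff ℝ 1 X) : ContDiff ℝ 1 (polarRadial X) := by
  have h := hX.comp contDiff_polarMap
  have hre : ContDiff ℝ 1 fun q => (X (polarMap q)).re := Complex.reCLM.contDiff.comp h
  have him : ContDiff ℝ 1 fun q => (X (polarMap q)).im := Complex.imCLM.contDiff.comp h
  exact contDiff_fst.mul ((hre.mul (Real.contDiff_cos.comp contDiff_snd)).add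
    (him.mul (Real.contDiff_sin.comp contDiff_snd)))

lemma contDiff_polarAngular {X : ℂ → ℂ} (hX : ContDiff ℝ 1 X) : ContDiff ℝ 1 (polarAngular X) := by
  have h := hX.comp contDiff_polarMap
  have hre : ContDiff ℝ 1 fun q => (X (polarMap q)).re := Complex.reCLM.contDiff.comp h
  have him : ContDiff ℝ 1 fun q => (X (polarMap q)).im := Complex.imCLM.contDiff.comp h
  exact (him.mul (Real.contDiff_cos.comp contDiff_snd)).sub
    (hre.mul (Real.contDiff_sin.comp contDiff_snd))

/-- The divergence in polar coordinates. -/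
lemma fderiv_polar_add_eq_divergence {X : ℂ → ℂ} (hX : ContDiff ℝ 1 X) (q : ℝ × ℝ) :
    fderiv ℝ (polarRadial X) q (1, 0) + fderiv ℝ (polarAngular X) q (0, 1) =
      q.1 * divergence X (polarMap q) := by
  obtain ⟨r, θ⟩ := q
  set L := fderiv ℝ X (polarMap (r, θ)) with hL
  set c := Real.cos θ with hc
  set s := Real.sin θ with hs
  have hXd : HasFDerivAt X L (polarMap (r, θ)) := (hX.differentiable (by simp) _).hasFDerivAt
  have hLv : ∀ v : ℂ, L v = v.re • L 1 + v.im • L Complex.I := by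
    intro v
    conv_lhs => rw [show v = v.re • (1 : ℂ) + v.im • Complex.I by simp]
    rw [map_add, map_smul, map_smul]
  have h1 : HasDerivAt (fun r : ℝ => polarMap (r, θ)) (c + s * Complex.I) r := by
    simpa [polarMap, hc, hs] using (Complex.ofRealCLM.hasDerivAt (x := r)).mul_const
      ((c : ℂ) + s * Complex.I)
  have h2 : HasDerivAt (fun θ : ℝ => polarMap (r, θ)) (r * (-s + c * Complex.I)) θ := by
    have := ((Real.hasDerivAt_cos θ).ofReal_comp.add
      ((Real.hasDerivAt_sin θ).ofReal_comp.mul_const Complex.I)).const_mul (r : ℂ)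
    simpa [polarMap, hc, hs] using this
  have hX1 := hXd.comp_hasDerivAt r h1
  have hX2 := HasFDerivAt.comp_hasDerivAt (f := fun θ : ℝ => polarMap (r, θ)) θ hXd h2
  have h1re : HasDerivAt (fun r : ℝ => (X (polarMap (r, θ))).re) (L (c + s * Complex.I)).re r :=
    Complex.reCLM.hasFDerivAt.comp_hasDerivAt r hX1
  have h1im : HasDerivAt (fun r : ℝ => (X (polarMap (r, θ))).im) (L (c + s * Complex.I)).im r :=
    Complex.imCLM.hasFDerivAt.comp_hasDerivAt r hX1
  have h2re : HasDerivAt (fun θ : ℝ => (X (polarMap (r, θ))).re)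
      (L (r * (-s + c * Complex.I))).re θ := Complex.reCLM.hasFDerivAt.comp_hasDerivAt θ hX2
  have h2im : HasDerivAt (fun θ : ℝ => (X (polarMap (r, θ))).im)
      (L (r * (-s + c * Complex.I))).im θ := Complex.imCLM.hasFDerivAt.comp_hasDerivAt θ hX2
  have hf : HasDerivAt (fun r : ℝ => polarRadial X (r, θ)) _ r :=
    (hasDerivAt_id r).mul ((h1re.mul_const c).add (h1im.mul_const s))
  have hg : HasDerivAt (fun θ : ℝ => polarAngular X (r, θ)) _ θ :=
    (h2im.mul (Real.hasDerivAt_cos θ)).sub (h2re.mul (Real.hasDerivAt_sin θ))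
  have hf' : HasDerivAt (fun r : ℝ => polarRadial X (r, θ))
      (fderiv ℝ (polarRadial X) (r, θ) (1, 0)) r :=
    HasFDerivAt.comp_hasDerivAt (f := fun r : ℝ => (r, θ)) r
      ((contDiff_polarRadial hX).differentiable (by simp) _).hasFDerivAt
      ((hasDerivAt_id r).prodMk (hasDerivAt_const r θ))
  have hg' : HasDerivAt (fun θ : ℝ => polarAngular X (r, θ))
      (fderiv ℝ (polarAngular X) (r, θ) (0, 1)) θ :=
    HasFDerivAt.comp_hasDerivAt (f := fun θ : ℝ => (r, θ)) θ
      ((contDiff_polarAngular hX).differentiable (by simp) _).hasFDerivAt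
      ((hasDerivAt_const θ r).prodMk (hasDerivAt_id θ))
  rw [hf'.unique hf, hg'.unique hg, divergence_eq, divergenceCLM_apply, ← hL,
    hLv (c + s * Complex.I), hLv (r * (-s + c * Complex.I))]
  have hcs : c ^ 2 + s ^ 2 = 1 := Real.cos_sq_add_sin_sq θ
  simp [-Complex.ofReal_cos, -Complex.ofReal_sin, ← hc, ← hs]
  linear_combination (r * ((L 1).re + (L Complex.I).im)) * hcs

/-- The divergence theorem on a disc, for a field that vanishes on the negative real axis. -/
lemma setIntegral_ball_divergence_eq {X : ℂ → ℂ} (hX : ContDiff ℝ 1 X)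
    (h0 : ∀ x : ℝ, x ≤ 0 → X x = 0) {R : ℝ} (hR : 0 < R) :
    ∫ z in Metric.ball 0 R, divergence X z =
      ∫ θ in (-Real.pi)..Real.pi, polarRadial X (R, θ) := by
  have hπ := Real.pi_pos
  have h1 : ∫ z in Metric.ball 0 R, divergence X z =
      ∫ q in Ioo 0 R ×ˢ Ioo (-Real.pi) Real.pi, q.1 * divergence X (polarMap q) := by
    rw [← integral_indicator Metric.isOpen_ball.measurableSet,
      ← Complex.integral_comp_polarCoord_symm, polarCoord_target]
    have h2 : Ioo 0 R ×ˢ Ioo (-Real.pi) Real.pi =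
        (Ioi (0 : ℝ) ×ˢ Ioo (-Real.pi) Real.pi) ∩ (Iio R ×ˢ univ) := by
      rw [prod_inter_prod, Ioi_inter_Iio, inter_univ]
    rw [h2, ← setIntegral_indicator (measurableSet_Iio.prod MeasurableSet.univ)]
    refine setIntegral_congr_fun (measurableSet_Ioi.prod measurableSet_Ioo) fun q hq => ?_
    have hq0 : 0 < q.1 := hq.1
    have h3 : Complex.polarCoord.symm q = polarMap q := Complex.polarCoord_symm_apply q
    simp only [h3]
    have h4 : ‖polarMap q‖ = q.1 := by rw [polarMap, norm_polar, abs_of_pos hq0]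
    by_cases hqR : q.1 < R
    · rw [indicator_of_mem (by simpa [h4] using hqR),
        indicator_of_mem (mk_mem_prod (mem_Iio.2 hqR) (mem_univ _)), smul_eq_mul]
    · rw [indicator_of_notMem (by simpa [h4] using hqR), indicator_of_notMem (fun h => hqR h.1),
        smul_zero]
  have h2 : (Ioo 0 R ×ˢ Ioo (-Real.pi) Real.pi : Set (ℝ × ℝ)) =ᵐ[volume]
      Icc ((0 : ℝ), -Real.pi) (R, Real.pi) := by
    rw [← Icc_prod_Icc]
    exact Measure.set_prod_ae_eq Ioo_ae_eq_Icc Ioo_ae_eq_Icc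
  have hf := contDiff_polarRadial hX
  have hg := contDiff_polarAngular hX
  rw [h1, setIntegral_congr_set h2]
  simp_rw [← fderiv_polar_add_eq_divergence hX]
  rw [integral_divergence_prod_Icc_of_hasFDerivAt_of_le (polarRadial X) (polarAngular X)
    (fderiv ℝ (polarRadial X)) (fderiv ℝ (polarAngular X)) (0, -Real.pi) (R, Real.pi)
    ⟨hR.le, by simp only; linarith⟩ hf.continuous.continuousOn hg.continuous.continuousOn
    (fun q _ => (hf.differentiable (by simp) q).hasFDerivAt)
    (fun q _ => (hg.differentiable (by simp) q).hasFDerivAt)]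
  · have e1 : ∀ r ∈ uIcc 0 R, polarAngular X (r, Real.pi) = 0 := by
      intro r hr
      rw [uIcc_of_le hR.le] at hr
      have : polarMap (r, Real.pi) = ((-r : ℝ) : ℂ) := by simp [polarMap]
      rw [polarAngular, this, h0 (-r) (by linarith [hr.1])]
      simp
    have e2 : ∀ r ∈ uIcc 0 R, polarAngular X (r, -Real.pi) = 0 := by
      intro r hr
      rw [uIcc_of_le hR.le] at hr
      have : polarMap (r, -Real.pi) = ((-r : ℝ) : ℂ) := by simp [polarMap]
      rw [polarAngular, this, h0 (-r) (by linarith [hr.1])]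
      simp
    have e3 : ∀ θ, polarRadial X (0, θ) = 0 := fun θ => by simp [polarRadial]
    simp only [e3]
    rw [intervalIntegral.integral_congr (g := fun _ => (0 : ℝ)) e1,
      intervalIntegral.integral_congr (g := fun _ => (0 : ℝ)) e2]
    simp
  · refine Continuous.integrableOn_Icc ?_
    exact ((hf.continuous_fderiv (by simp)).clm_apply continuous_const).add
      ((hg.continuous_fderiv (by simp)).clm_apply continuous_const)

lemma polarMap_mem_sector_iff {θ₀ r θ : ℝ} (h : θ₀ ≤ Real.pi) (hr : 0 < r)
    (hθ : θ ∈ Ioc (-Real.pi) Real.pi) :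
    polarMap (r, θ) ∈ sector θ₀ ↔ θ ∈ Ioo 0 θ₀ := by
  rw [sector_eq h, mem_ofPred_eq, polarMap, Complex.ofReal_cos, Complex.ofReal_sin,
    Complex.arg_mul_cos_add_sin_mul_I hr hθ, mem_Ioo]

/-- The perimeter of a disc sector is at most the weighted length of its arc. -/
lemma weightedPerimeter_discSector_le {p : ℝ} (hp : 0 < p) {R : ℝ} (hR : 0 < R) :
    weightedPerimeter (sector (Real.pi / (p + 1))) (powDensity p)
      (discSector (Real.pi / (p + 1)) R) ≤
      ENNReal.ofReal (Real.pi / (p + 1) * (R * R ^ p)) := by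
  have hπ := Real.pi_pos
  have hθπ := sector_angle_lt_pi hp
  set θ₀ := Real.pi / (p + 1) with hθ₀
  have hθ0 : 0 < θ₀ := by positivity
  refine iSup₂_le fun X hX => ENNReal.ofReal_le_ofReal ?_
  have hout : ∀ z ∉ sector θ₀, X z = 0 := fun z hz =>
    image_eq_zero_of_notMem_tsupport fun h => hz (hX.tsupport_subset h)
  have h1 : ∫ z in discSector θ₀ R, divergence X z = ∫ z in Metric.ball 0 R, divergence X z := by
    have hs : discSector θ₀ R = Metric.ball 0 R ∩ sector θ₀ := by
      ext z; simp [discSector, and_comm]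
    rw [hs]
    refine (setIntegral_eq_of_subset_of_forall_sdiff_eq_zero Metric.isOpen_ball.measurableSet
      inter_subset_left fun z hz => ?_).symm
    have hz' : z ∉ tsupport X := fun h => hz.2 ⟨hz.1, hX.tsupport_subset h⟩
    rw [divergence_eq, (notMem_tsupport_iff_eventuallyEq.1 hz').fderiv_eq]
    simp [divergenceCLM_apply]
  rw [h1, setIntegral_ball_divergence_eq hX.contDiff _ hR]
  · have h2 : ∀ θ ∈ Ioc (-Real.pi) Real.pi, polarRadial X (R, θ) ≤
        (Ioo 0 θ₀).indicator (fun _ => R * R ^ p) θ := by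
      intro θ hθ
      by_cases h : θ ∈ Ioo 0 θ₀
      · rw [indicator_of_mem h, polarRadial]
        have h3 : ‖X (polarMap (R, θ))‖ ≤ R ^ p := by
          refine (hX.norm_le _).trans (le_of_eq ?_)
          rw [powDensity, polarMap, norm_polar, abs_of_pos hR]
        -- The radial component is the real part of the field times the conjugate unit radial
        -- vector.
        have h4 := Complex.abs_re_le_norm
          (X (polarMap (R, θ)) * (starRingEnd ℂ) (Real.cos θ + Real.sin θ * Complex.I))
        have h5 : ‖(starRingEnd ℂ) (Real.cos θ + Real.sin θ * Complex.I : ℂ)‖ = 1 := by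
          rw [RCLike.norm_conj]
          have := norm_polar 1 θ
          rwa [Complex.ofReal_one, one_mul, abs_one] at this
        rw [norm_mul, h5, mul_one] at h4
        have h6 : (X (polarMap (R, θ)) *
            (starRingEnd ℂ) (Real.cos θ + Real.sin θ * Complex.I)).re =
            (X (polarMap (R, θ))).re * Real.cos θ + (X (polarMap (R, θ))).im * Real.sin θ := by
          simp [-Complex.ofReal_cos, -Complex.ofReal_sin]
        rw [h6] at h4
        have h7 := (le_abs_self _).trans (h4.trans h3)
        exact mul_le_mul_of_nonneg_left h7 hR.le
      · rw [indicator_of_notMem h, polarRadial, hout]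
        · simp
        · rwa [polarMap_mem_sector_iff hθπ.le hR hθ]
    rw [intervalIntegral.integral_of_le (by linarith)]
    have hc : Continuous fun θ => polarRadial X (R, θ) :=
      (contDiff_polarRadial hX.contDiff).continuous.comp (by fun_prop)
    refine (setIntegral_mono_on (hc.integrableOn_Icc.mono_set Ioc_subset_Icc_self)
      ((integrableOn_const (by simp)).indicator measurableSet_Ioo) measurableSet_Ioc h2).trans ?_
    rw [setIntegral_indicator measurableSet_Ioo, inter_eq_self_of_subset_right, setIntegral_const]
    · rw [measureReal_def, Real.volume_Ioo, sub_zero, ENNReal.toReal_ofReal hθ0.le, smul_eq_mul]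
    · intro θ hθ
      exact ⟨by linarith [hθ.1], by linarith [hθ.2]⟩
  · intro x hx
    refine hout _ fun h => ?_
    have := sector_subset_slitPlane hθπ.le h
    rw [Complex.ofReal_mem_slitPlane] at this
    linarith

/-- The integral of a power of the radius over a disc sector. -/
lemma lintegral_discSector_rpow {θ₀ a R : ℝ} (h0 : 0 < θ₀) (h : θ₀ < Real.pi) (ha : 0 ≤ a)
    (hR : 0 < R) :
    ∫⁻ z in discSector θ₀ R, ENNReal.ofReal (‖z‖ ^ a) =
      ENNReal.ofReal (θ₀ * (R ^ (a + 2) / (a + 2))) := by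
  have hm : MeasurableSet (discSector θ₀ R) :=
    (isOpen_sector h.le).measurableSet.inter (measurableSet_lt measurable_norm measurable_const)
  have hf : Measurable fun z : ℂ => ENNReal.ofReal (‖z‖ ^ a) := by fun_prop
  rw [← lintegral_indicator hm, lintegral_polar (hf.indicator hm)]
  have h1 : ∀ θ ∈ Ioo (-Real.pi) Real.pi, (∫⁻ r in Ioi (0 : ℝ), ENNReal.ofReal r *
      (discSector θ₀ R).indicator (fun z => ENNReal.ofReal (‖z‖ ^ a))
        (r * (Real.cos θ + Real.sin θ * Complex.I))) =
      (Ioo 0 θ₀).indicator (fun _ => ENNReal.ofReal (R ^ (a + 2) / (a + 2))) θ := by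
    intro θ hθ
    have hθ' : θ ∈ Ioc (-Real.pi) Real.pi := ⟨hθ.1, hθ.2.le⟩
    by_cases hs : θ ∈ Ioo 0 θ₀
    · rw [indicator_of_mem hs]
      have h2 : R ^ (a + 2) / (a + 2) = ∫ r in Ioo 0 R, r ^ (a + 1) := by
        rw [← integral_Ioc_eq_integral_Ioo, ← intervalIntegral.integral_of_le hR.le,
          integral_rpow (Or.inl (by linarith)), add_assoc, one_add_one_eq_two,
          Real.zero_rpow (by linarith), sub_zero]
      have hint : IntegrableOn (fun r : ℝ => r ^ (a + 1)) (Ioo 0 R) := by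
        refine (Continuous.integrableOn_Icc ?_).mono_set Ioo_subset_Icc_self
        exact Real.continuous_rpow_const (by linarith)
      rw [h2, ofReal_integral_eq_lintegral_ofReal hint
        ((ae_restrict_mem measurableSet_Ioo).mono fun r hr => Real.rpow_nonneg hr.1.le _),
        ← Ioi_inter_Iio, inter_comm, ← setLIntegral_indicator measurableSet_Iio]
      refine setLIntegral_congr_fun measurableSet_Ioi fun r hr => ?_
      have hr0 : (0 : ℝ) < r := hr
      have hmem : (r : ℂ) * (Real.cos θ + Real.sin θ * Complex.I) ∈ discSector θ₀ R ↔ r < R := by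
        rw [discSector, mem_ofPred_eq, norm_polar, abs_of_pos hr0]
        exact and_iff_right ((polarMap_mem_sector_iff h.le hr0 hθ').2 hs)
      by_cases hrR : r < R
      · rw [indicator_of_mem (hmem.2 hrR), indicator_of_mem (mem_Iio.2 hrR), norm_polar, abs_of_pos hr0,
          ← ENNReal.ofReal_mul hr0.le, Real.rpow_add_one hr0.ne', mul_comm]
      · rw [indicator_of_notMem (fun h => hrR (hmem.1 h)),
          indicator_of_notMem (by simpa using hrR), mul_zero]
    · rw [indicator_of_notMem hs, setLIntegral_congr_fun measurableSet_Ioi (g := fun _ => 0)]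
      · simp
      · intro r hr
        simp only
        rw [indicator_of_notMem, mul_zero]
        intro hz
        exact hs ((polarMap_mem_sector_iff h.le hr hθ').1 hz.1)
  rw [setLIntegral_congr_fun measurableSet_Ioo h1, setLIntegral_indicator measurableSet_Ioo,
    inter_eq_self_of_subset_left, setLIntegral_const, Real.volume_Ioo, sub_zero, mul_comm,
    ← ENNReal.ofReal_mul h0.le]
  exact Ioo_subset_Ioo (by linarith [Real.pi_pos]) h.le

/-! ### Null sets and the boundary of the disc sector -/

lemma measurableSet_discSector {θ₀ : ℝ} (h : θ₀ ≤ Real.pi) (R : ℝ) :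
    MeasurableSet (discSector θ₀ R) :=
  (isOpen_sector h).measurableSet.inter (measurableSet_lt measurable_norm measurable_const)

lemma weightedArea_congr {f : ℂ → ℝ} {E F : Set ℂ} (h : E =ᵐ[volume] F) :
    weightedArea f E = weightedArea f F := setLIntegral_congr h

lemma weightedPerimeter_congr {Ω E F : Set ℂ} {f : ℂ → ℝ} (h : E =ᵐ[volume] F) :
    weightedPerimeter Ω f E = weightedPerimeter Ω f F := by
  unfold weightedPerimeter
  simp_rw [setIntegral_congr_set h]

lemma boundaryIn_congr {Ω E F : Set ℂ} (h : E =ᵐ[volume] F) :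
    boundaryIn Ω E = boundaryIn Ω F := by
  have h1 : ∀ z ε, volume (E ∩ Metric.ball z ε) = volume (F ∩ Metric.ball z ε) := fun z ε =>
    measure_congr (h.inter (ae_eq_refl _))
  have h2 : ∀ z ε, volume ((Ω \ E) ∩ Metric.ball z ε) = volume ((Ω \ F) ∩ Metric.ball z ε) :=
    fun z ε => measure_congr (((ae_eq_refl Ω).diff h).inter (ae_eq_refl _))
  simp_rw [boundaryIn, h1, h2]

lemma smul_mem_sector {θ₀ : ℝ} {z : ℂ} (hz : z ∈ sector θ₀) {t : ℝ} (ht : 0 < t) :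
    (t : ℂ) * z ∈ sector θ₀ := by
  obtain ⟨r, θ, hr, h0, h1, rfl⟩ := hz
  exact ⟨t * r, θ, by positivity, h0, h1, by push_cast; ring⟩

/-- Off the arc, a small ball misses one of the two sides. On the arc, the multiples `t * z` with
`t` near `1` remain in the sector and reach both open sides, and nonempty open sets have positive
area. -/
lemma boundaryIn_discSector {θ₀ : ℝ} (h : θ₀ ≤ Real.pi) {R : ℝ} (hR : 0 < R) :
    boundaryIn (sector θ₀) (discSector θ₀ R) = circularArc θ₀ R := by
  have hSo := isOpen_sector h
  ext z
  constructor
  · rintro ⟨hz, hb⟩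
    refine ⟨hz, ?_⟩
    rcases lt_trichotomy ‖z‖ R with hlt | heq | hgt
    · exfalso
      refine (hb (R - ‖z‖) (by linarith)).2 (measure_mono_null (t := ∅) ?_ measure_empty)
      rintro y ⟨⟨hyS, hyD⟩, hy⟩
      refine hyD ⟨hyS, ?_⟩
      have h1 : ‖y - z‖ < R - ‖z‖ := by simpa [dist_eq_norm] using hy
      have h2 := norm_sub_norm_le y z
      linarith
    · exact heq
    · exfalso
      refine (hb (‖z‖ - R) (by linarith)).1 (measure_mono_null (t := ∅) ?_ measure_empty)
      rintro y ⟨⟨hyS, hyD⟩, hy⟩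
      have h1 : ‖y - z‖ < ‖z‖ - R := by simpa [dist_eq_norm] using hy
      have h2 := norm_sub_norm_le z y
      rw [norm_sub_rev] at h2
      linarith
  · rintro ⟨hz, hzR⟩
    have hc : Tendsto (fun t : ℝ => (t : ℂ) * z) (𝓝 1) (𝓝 z) := by
      have : Continuous fun t : ℝ => (t : ℂ) * z := by fun_prop
      simpa using this.tendsto 1
    refine ⟨hz, fun ε hε => ?_⟩
    have hnear := hc.eventually (Metric.ball_mem_nhds z hε)
    have hpos : ∀ᶠ t : ℝ in 𝓝 1, 0 < t := lt_mem_nhds one_pos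
    have hnorm : ∀ t : ℝ, 0 < t → ‖(t : ℂ) * z‖ = t * R := fun t ht => by
      rw [norm_mul, Complex.norm_real, Real.norm_of_nonneg ht.le, hzR]
    constructor
    · have ho : IsOpen (discSector θ₀ R ∩ Metric.ball z ε) :=
        (hSo.inter (isOpen_lt continuous_norm continuous_const)).inter Metric.isOpen_ball
      obtain ⟨t, ⟨ht1, ht0⟩, ht⟩ := (((hnear.and hpos).filter_mono nhdsWithin_le_nhds).and
        (self_mem_nhdsWithin (s := Iio (1 : ℝ)))).exists
      refine (ho.measure_pos volume ⟨(t : ℂ) * z, ⟨smul_mem_sector hz ht0, ?_⟩, ht1⟩).ne'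
      rw [hnorm t ht0]
      have : t < 1 := ht
      nlinarith
    · have ho : IsOpen ((sector θ₀ ∩ {y | R < ‖y‖}) ∩ Metric.ball z ε) :=
        (hSo.inter (isOpen_lt continuous_const continuous_norm)).inter Metric.isOpen_ball
      obtain ⟨t, ⟨ht1, ht0⟩, ht⟩ := (((hnear.and hpos).filter_mono nhdsWithin_le_nhds).and
        (self_mem_nhdsWithin (s := Ioi (1 : ℝ)))).exists
      have h1 := ho.measure_pos volume ⟨(t : ℂ) * z, ⟨smul_mem_sector hz ht0, by
        change R < ‖(t : ℂ) * z‖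
        rw [hnorm t ht0]
        have : 1 < t := ht
        nlinarith⟩, ht1⟩
      refine (h1.trans_le (measure_mono ?_)).ne'
      rintro y ⟨⟨hyS, hyR⟩, hy⟩
      exact ⟨⟨hyS, fun hyD => lt_asymm hyR hyD.2⟩, hy⟩

lemma integrableOn_of_setLIntegral_ne_top {f : ℂ → ℝ} (hf : Measurable f) (h0 : ∀ z, 0 ≤ f z)
    {E : Set ℂ} (h : ∫⁻ z in E, ENNReal.ofReal (f z) ≠ ⊤) : IntegrableOn f E := by
  refine ⟨hf.aestronglyMeasurable, ?_⟩
  rw [hasFiniteIntegral_iff_ofReal (Eventually.of_forall h0)]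
  exact h.lt_top

/-! ### The disc sector minimizes conformal area -/

/-- Among the sets of given weighted area the disc sector has least conformal area, uniquely up to
null sets. -/
lemma ae_eq_discSector_of_conformalArea_le {θ₀ p R : ℝ} (hθ : θ₀ ≤ Real.pi) (hp : 0 < p)
    (hR : 0 < R) {E : Set ℂ} (hEm : MeasurableSet E) (hE : E ⊆ sector θ₀)
    (hA : weightedArea (powDensity p) E = weightedArea (powDensity p) (discSector θ₀ R))
    (hA' : weightedArea (powDensity p) (discSector θ₀ R) ≠ ⊤)
    (hC : conformalArea p E ≤ conformalArea p (discSector θ₀ R))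
    (hC' : conformalArea p (discSector θ₀ R) ≠ ⊤) :
    E =ᵐ[volume] discSector θ₀ R := by
  set D := discSector θ₀ R with hD
  have hDm : MeasurableSet D := measurableSet_discSector hθ R
  have hk : Measurable fun z : ℂ => ‖z‖ ^ p := measurable_rpow_norm p
  have hk0 : ∀ z : ℂ, 0 ≤ ‖z‖ ^ p := fun z => by positivity
  have hk0' : ∀ z : ℂ, 0 ≤ (‖z‖ ^ p) ^ 2 := fun z => by positivity
  have i1E : IntegrableOn (fun z : ℂ => ‖z‖ ^ p) E :=
    integrableOn_of_setLIntegral_ne_top hk hk0 (hA.trans_ne hA')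
  have i1D : IntegrableOn (fun z : ℂ => ‖z‖ ^ p) D :=
    integrableOn_of_setLIntegral_ne_top hk hk0 hA'
  have i2E : IntegrableOn (fun z : ℂ => (‖z‖ ^ p) ^ 2) E :=
    integrableOn_of_setLIntegral_ne_top (hk.pow_const 2) hk0' (ne_top_of_le_ne_top hC' hC)
  have i2D : IntegrableOn (fun z : ℂ => (‖z‖ ^ p) ^ 2) D :=
    integrableOn_of_setLIntegral_ne_top (hk.pow_const 2) hk0' hC'
  -- The constant `R ^ p` acts as a Lagrange multiplier: on the sector `u` is negative exactly
  -- inside the disc. As the weighted areas agree, comparing conformal areas is comparing integrals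
  -- of `u`.
  set u : ℂ → ℝ := fun z => (‖z‖ ^ p) ^ 2 - R ^ p * ‖z‖ ^ p with hu
  have iuE : IntegrableOn u E := i2E.sub (i1E.const_mul _)
  have iuD : IntegrableOn u D := i2D.sub (i1D.const_mul _)
  have hu_eq : ∀ z, u z = ‖z‖ ^ p * (‖z‖ ^ p - R ^ p) := fun z => by simp only [hu]; ring
  have hle : ∫ z in E, u z ≤ ∫ z in D, u z := by
    have e1 : ∫ z in E, ‖z‖ ^ p = ∫ z in D, ‖z‖ ^ p := by
      rw [integral_eq_lintegral_of_nonneg_ae (Eventually.of_forall hk0) hk.aestronglyMeasurable,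
        integral_eq_lintegral_of_nonneg_ae (Eventually.of_forall hk0) hk.aestronglyMeasurable]
      exact congrArg ENNReal.toReal hA
    have e2 : ∫ z in E, (‖z‖ ^ p) ^ 2 ≤ ∫ z in D, (‖z‖ ^ p) ^ 2 := by
      rw [integral_eq_lintegral_of_nonneg_ae (Eventually.of_forall hk0')
          (hk.pow_const 2).aestronglyMeasurable,
        integral_eq_lintegral_of_nonneg_ae (Eventually.of_forall hk0')
          (hk.pow_const 2).aestronglyMeasurable]
      exact ENNReal.toReal_mono hC' hC
    simp only [hu]
    rw [integral_sub i2E (i1E.const_mul _), integral_sub i2D (i1D.const_mul _),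
      integral_const_mul, integral_const_mul, e1]
    linarith
  have hsplitE := integral_inter_add_sdiff (s := E) hDm iuE
  have hsplitD := integral_inter_add_sdiff (s := D) hEm iuD
  rw [inter_comm] at hsplitD
  have hnn : ∀ z ∈ E \ D, 0 ≤ u z := by
    intro z hz
    rw [hu_eq]
    have h1 : R ≤ ‖z‖ := not_lt.1 fun h => hz.2 ⟨hE hz.1, h⟩
    have h2 := Real.rpow_le_rpow hR.le h1 hp.le
    exact mul_nonneg (hk0 z) (by linarith)
  have hneg : ∀ z ∈ D \ E, u z < 0 := by
    intro z hz
    rw [hu_eq]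
    have h0 : 0 < ‖z‖ :=
      norm_pos_iff.2 (Complex.slitPlane_ne_zero (sector_subset_slitPlane hθ hz.1.1))
    have h2 := Real.rpow_lt_rpow h0.le hz.1.2 hp
    exact mul_neg_of_pos_of_neg (Real.rpow_pos_of_pos h0 _) (by linarith)
  have hI1 : 0 ≤ ∫ z in E \ D, u z := setIntegral_nonneg (hEm.diff hDm) hnn
  have hI2 : ∫ z in D \ E, u z ≤ 0 :=
    setIntegral_nonpos (hDm.diff hEm) fun z hz => (hneg z hz).le
  -- The integral of `u` over `E \ D` is at most that over `D \ E`; the former is nonnegative and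
  -- the latter nonpositive, so both vanish.
  have hz1 : ∫ z in E \ D, u z = 0 := by linarith
  have hz2 : ∫ z in D \ E, (-u) z = 0 := by
    simp only [Pi.neg_apply]
    rw [integral_neg]
    linarith
  have hED : volume (E \ D) = 0 := by
    rw [setIntegral_eq_zero_iff_of_nonneg_ae
      ((ae_restrict_mem (hEm.diff hDm)).mono hnn) (iuE.mono_set sdiff_subset)] at hz1
    have h1 := ae_imp_of_ae_restrict hz1
    -- Outside the disc `u` vanishes only on the circle of radius `R`, a null set.
    have h2 : ∀ᵐ z : ℂ, z ∉ Metric.sphere (0 : ℂ) R :=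
      measure_eq_zero_iff_ae_notMem.1 (Measure.addHaar_sphere volume 0 R)
    rw [measure_eq_zero_iff_ae_notMem]
    filter_upwards [h1, h2] with z hz hz' hzE
    have h3 : u z = 0 := hz hzE
    rw [hu_eq, mul_eq_zero] at h3
    have h0 : 0 < ‖z‖ :=
      norm_pos_iff.2 (Complex.slitPlane_ne_zero (sector_subset_slitPlane hθ (hE hzE.1)))
    rcases h3 with h3 | h3
    · exact (Real.rpow_pos_of_pos h0 p).ne' h3
    · refine hz' ?_
      rw [mem_sphere_zero_iff_norm]
      exact (Real.rpow_left_inj h0.le hR.le hp.ne').1 (by linarith)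
  have hDE : volume (D \ E) = 0 := by
    rw [setIntegral_eq_zero_iff_of_nonneg_ae
      ((ae_restrict_mem (hDm.diff hEm)).mono fun z hz => by
        have := hneg z hz
        simp only [Pi.zero_apply, Pi.neg_apply]
        linarith) (iuD.mono_set sdiff_subset).neg] at hz2
    rw [measure_eq_zero_iff_ae_notMem]
    filter_upwards [ae_imp_of_ae_restrict hz2] with z hz hzD
    have h3 : -u z = 0 := hz hzD
    have := hneg z hzD
    linarith
  exact ae_eq_set.2 ⟨hED, hDE⟩

end SectorIso

end

/-! ### The isoperimetric theorem in the sector -/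

theorem mainTheorem9 (p : ℝ) (hp : 0 < p) (A : ℝ) (hA : 0 < A) :
    ∃ R : ℝ, 0 < R ∧
      SectorIso.weightedArea (SectorIso.powDensity p)
        (SectorIso.discSector (Real.pi / (p + 1)) R) = ENNReal.ofReal A ∧
      (∀ E : Set ℂ,
        SectorIso.IsIsoperimetricRegion (SectorIso.sector (Real.pi / (p + 1)))
            (SectorIso.powDensity p) A E ↔
          MeasurableSet E ∧ E ⊆ SectorIso.sector (Real.pi / (p + 1)) ∧
            E =ᵐ[MeasureTheory.volume] SectorIso.discSector (Real.pi / (p + 1)) R) ∧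
      (∀ C : Set ℂ,
        SectorIso.IsIsoperimetricCurve (SectorIso.sector (Real.pi / (p + 1)))
            (SectorIso.powDensity p) A C ↔
          C = SectorIso.circularArc (Real.pi / (p + 1)) R) := by
  open SectorIso in
  have hθπ := sector_angle_lt_pi hp
  have hπ := Real.pi_pos
  have hθ0 : 0 < Real.pi / (p + 1) := by positivity
  have hp1 : p + 1 ≠ 0 := by linarith
  have hp2 : p + 2 ≠ 0 := by linarith
  obtain ⟨R, hR, hRA⟩ : ∃ R : ℝ, 0 < R ∧ Real.pi / (p + 1) * (R ^ (p + 2) / (p + 2)) = A := by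
    refine ⟨((p + 2) * A / (Real.pi / (p + 1))) ^ (p + 2)⁻¹, by positivity, ?_⟩
    rw [Real.rpow_inv_rpow (by positivity) hp2]
    field_simp
  have hm := measurableSet_discSector hθπ.le R
  have harea : weightedArea (powDensity p) (discSector (Real.pi / (p + 1)) R) =
      ENNReal.ofReal A := by
    rw [← hRA]
    exact lintegral_discSector_rpow hθ0 hθπ hp.le hR
  set Q := Real.pi / (p + 1) * (R * R ^ p) with hQ
  have hQ0 : 0 ≤ Q := by positivity
  -- This is equality in the half-plane inequality: the image is a half disc of radius `R ^ (p + 1)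
  -- / (p + 1)`, and `Q` is the length of its arc.
  have hconf : conformalArea p (discSector (Real.pi / (p + 1)) R) =
      ENNReal.ofReal (Q ^ 2 / (2 * Real.pi)) := by
    have h1 : ∀ z : ℂ, (‖z‖ ^ p) ^ 2 = ‖z‖ ^ (p * 2) := fun z => by
      rw [Real.rpow_mul (norm_nonneg z), Real.rpow_two]
    simp_rw [conformalArea, h1]
    rw [lintegral_discSector_rpow hθ0 hθπ (by positivity) hR, hQ, Real.rpow_add hR,
      Real.rpow_mul hR.le, Real.rpow_two, Real.rpow_two]
    congr 1
    field_simp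
  have hPD := weightedPerimeter_discSector_le hp hR
  have hreg : ∀ E : Set ℂ, MeasurableSet E → E ⊆ sector (Real.pi / (p + 1)) →
      weightedArea (powDensity p) E = ENNReal.ofReal A →
      conformalArea p E ≤ conformalArea p (discSector (Real.pi / (p + 1)) R) →
      E =ᵐ[volume] discSector (Real.pi / (p + 1)) R := fun E hEm hE hEA hEC =>
    ae_eq_discSector_of_conformalArea_le hθπ.le hp hR hEm hE (hEA.trans harea.symm)
      (by rw [harea]; exact ENNReal.ofReal_ne_top) hEC
      (by rw [hconf]; exact ENNReal.ofReal_ne_top)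
  have hmin : ∀ F : Set ℂ, MeasurableSet F → F ⊆ sector (Real.pi / (p + 1)) →
      weightedArea (powDensity p) F = ENNReal.ofReal A →
      ENNReal.ofReal Q ≤ weightedPerimeter (sector (Real.pi / (p + 1))) (powDensity p) F := by
    -- A perimeter below `Q` would force a conformal area strictly below that of the disc sector.
    -- But then `F` agrees with the disc sector up to a null set, so the two conformal areas
    -- coincide. Hence no lower bound for the perimeter of the disc sector itself has to be
    -- computed.
    intro F hFm hF hFA
    by_contra! hlt
    have hne := ne_top_of_lt hlt
    rw [← ENNReal.ofReal_toReal hne] at hlt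
    have hQ' : (weightedPerimeter (sector (Real.pi / (p + 1))) (powDensity p) F).toReal < Q :=
      (ENNReal.ofReal_lt_ofReal_iff_of_nonneg ENNReal.toReal_nonneg).1 hlt
    have h1 := conformalArea_le_of_weightedPerimeter_le hp hFm hF
      (by rw [hFA]; exact ENNReal.ofReal_ne_top) ENNReal.toReal_nonneg
      (ENNReal.ofReal_toReal hne).ge
    have h2 : conformalArea p F < conformalArea p (discSector (Real.pi / (p + 1)) R) := by
      refine h1.trans_lt ?_
      rw [hconf]
      refine (ENNReal.ofReal_lt_ofReal_iff_of_nonneg (by positivity)).2 ?_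
      gcongr
    exact h2.ne (setLIntegral_congr (hreg F hFm hF hFA h2.le))
  have hiff : ∀ E : Set ℂ,
      IsIsoperimetricRegion (sector (Real.pi / (p + 1))) (powDensity p) A E ↔
        MeasurableSet E ∧ E ⊆ sector (Real.pi / (p + 1)) ∧
          E =ᵐ[volume] discSector (Real.pi / (p + 1)) R := by
    intro E
    constructor
    · intro hE
      refine ⟨hE.measurableSet, hE.subset, hreg E hE.measurableSet hE.subset hE.area_eq ?_⟩
      rw [hconf]
      exact conformalArea_le_of_weightedPerimeter_le hp hE.measurableSet hE.subset
        (by rw [hE.area_eq]; exact ENNReal.ofReal_ne_top) hQ0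
        ((hE.perimeter_le _ hm (fun z hz => hz.1) harea).trans hPD)
    · rintro ⟨hEm, hE, hae⟩
      refine ⟨hEm, hE, (weightedArea_congr hae).trans harea, fun F hFm hF hFA => ?_⟩
      rw [weightedPerimeter_congr hae]
      exact hPD.trans (hmin F hFm hF hFA)
  refine ⟨R, hR, harea, hiff, fun C => ?_⟩
  rw [← boundaryIn_discSector hθπ.le hR]
  constructor
  · rintro ⟨E, hE, rfl⟩
    exact boundaryIn_congr ((hiff E).1 hE).2.2
  · rintro rfl
    exact ⟨_, (hiff _).2 ⟨hm, fun z hz => hz.1, ae_eq_refl _⟩, rfl⟩
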